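/- Let $R$ be a field and let $(E,\omega)$ be a row-finite weighted graph: countable sets $E^0$ (vertices) and $E^{\mathrm{st}}$ (structured edges), maps $s,r:E^{\mathrm{st}}\to E^0$ and $\omega:E^{\mathrm{st}}\to\{1,2,\dots\}$, with $s^{-1}(v)$ finite for every $v\in E^0$. Put $E^1=\{\alpha_i : \alpha\in E^{\mathrm{st}},\ 1\le i\le\omega(\alpha)\}$ and, for $v$ with $s^{-1}(v)\neq\emptyset$, $\omega(v)=\max\{\omega(\alpha) : s(\alpha)=v\}$. The weighted Leavitt path algebra $L_R(E,\omega)$ is the quotient of the free (not necessarily unital) $R$-algebra on $\{v,\alpha_i,\alpha_i^* : v\in E^0,\ \alpha_i\in E^1\}$ by the relations (1) $vw=\delta_{vw}v$ for $v,w\in E^0$; (2) $s(\alpha)\alpha_i=\alpha_i r(\alpha)=\alpha_i$ and $r(\alpha)\alpha_i^*=\alpha_i^*s(\alpha)=\alpha_i^*$; (3) $\sum_{s(\alpha)=v}\alpha_i\alpha_j^*=\delta_{ij}v$ for every $v$ with $s^{-1}(v)\ne\emptyset$ and $1\le i,j\le\omega(v)$; (4) $\sum_{1\le i\le\max\{\omega(\alpha),\omega(\beta)\}}\alpha_i^*\beta_i=\delta_{\alpha\beta}r(\alpha)$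 for $\alpha,\beta\in E^{\mathrm{st}}$; here $\alpha_i=\alpha_i^*=0$ for $i>\omega(\alpha)$. It is $\mathbb Z^n$-graded, $n=\max_\alpha\omega(\alpha)$, by $\deg v=0$, $\deg\alpha_i=e_i$, $\deg\alpha_i^*=-e_i$ (with $\bigoplus_{i\ge1}\mathbb Z$ in place of $\mathbb Z^n$ if the weights are unbounded). If $\omega=1$ we write $L_R(E)$ and use the $\mathbb Z$-grading $\deg v=0$, $\deg\alpha_1=1$, $\deg\alpha_1^*=-1$. Such an algebra is called graded simple if it is nonzero and its only graded two-sided ideals are $0$ and the whole algebra. Let $W\subseteq E^0$ (the weight forest) be the set of all vertices that can be reached by a (possibly trivial) directed path from a vertex that emits a structured edge of weight greater than $1$. Call $(E,\omega)$ reducible if, for every $v\in W$, at most one structured edge $\alpha$ has $s(\alpha)=v$, and at most one structured edge $\alpha$ has $r(\alpha)=v$ and $s(\alpha)\in W$ (this holds vacuously if all weights are $1$). Let $F$ be the unweighted graph with vertex set $E^0$ and one edge $e_{\alpha_i}$ for each $\alpha_i\in E^1$, which goes from $s(\alpha)$ to $r(\alpha)$ if $s(\alpha)\notin W$, and from $r(\alpha)$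 to $s(\alpha)$ if $s(\alpha)\in W$. (For unweighted graphs that are not row-finite, relation (3) is imposed only at those $v$ for which $s^{-1}(v)$ is finite and nonempty.) Then $L_R(E,\omega)$ is graded simple (for the $\mathbb Z^n$-grading) if and only if $(E,\omega)$ is reducible and $L_R(F)$ is graded simple (for the $\mathbb Z$-grading). -/

import Mathlib

universe u v w

/-- A weighted graph with vertex set `V` and set of structured edges `S`. -/
structure WeightedGraph (V : Type u) (S : Type v) where
  source : S → V
  range : S → V
  weight : S → ℕ
  weight_pos : ∀ α, 0 < weight α

namespace WeightedGraph

variable {V : Type u} {S : Type v} (E : WeightedGraph V S)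

/-- The edges `α_1, …, α_{ω(α)}` of all structured edges `α`. The edge `α_{i+1}` is `⟨α, i⟩`:
indices start at `0` here. -/
abbrev Edge : Type v := Σ α : S, Fin (E.weight α)

/-- Every vertex emits only finitely many structured edges. -/
def RowFinite : Prop := ∀ v : V, {α | E.source α = v}.Finite

/-- A vertex is weighted if the maximal weight of the structured edges it emits exceeds `1`,
that is, if it emits a structured edge of weight greater than `1`. -/
def IsWeightedVertex (v : V) : Prop := ∃ α, E.source α = v ∧ 1 < E.weight α

/-- There is a (possibly trivial) directed path from the first vertex to the second. -/
def Reaches : V → V → Prop :=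
  Relation.ReflTransGen fun a b => ∃ α, E.source α = a ∧ E.range α = b

/-- The weight forest: all vertices that can be reached from a weighted vertex. -/
def weightForest : Set V := {v | ∃ a, E.IsWeightedVertex a ∧ E.Reaches a v}

/-- Every vertex of the weight forest emits at most one structured edge, and receives at most one
structured edge whose source lies in the weight forest. (No condition if no vertex is weighted.) -/
def IsReducible : Prop :=
  ∀ v ∈ E.weightForest, {α | E.source α = v}.Subsingleton ∧
    {α | E.range α = v ∧ E.source α ∈ E.weightForest}.Subsingleton

open Classical in
/-- The associated unweighted graph: one edge for every edge `α_i`, which keeps its direction if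
`s(α)` does not lie in the weight forest, and is reversed if it does. -/
noncomputable def unweighted : WeightedGraph V E.Edge where
  source e := if E.source e.1 ∈ E.weightForest then E.range e.1 else E.source e.1
  range e := if E.source e.1 ∈ E.weightForest then E.source e.1 else E.range e.1
  weight _ := 1
  weight_pos _ := Nat.one_pos

/-- The alphabet: vertices `v`, edges `α_i`, and ghost edges `α_i^*`. -/
inductive Gen : Type (max u v)
  | vertex (v : V)
  | edge (e : E.Edge)
  | ghost (e : E.Edge)

variable (R : Type w) [CommRing R]

/-- The free (not necessarily unital) `R`-algebra on the alphabet: its basis consists of the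
nonempty words. -/
abbrev Free : Type (max u v w) := MonoidAlgebra R (FreeSemigroup E.Gen)

namespace Free

/-- A letter as an element of the free algebra. -/
noncomputable def letter (x : E.Gen) : E.Free R := MonoidAlgebra.single (FreeSemigroup.of x) 1

/-- The vertex `v` in the free algebra. -/
noncomputable def vertex (v : V) : E.Free R := letter E R (.vertex v)

/-- The element `α_{i+1}`, which is `0` if `i + 1` exceeds the weight of `α`. -/
noncomputable def edge (α : S) (i : ℕ) : E.Free R :=
  if h : i < E.weight α then letter E R (.edge ⟨α, i, h⟩) else 0

/-- The element `α_{i+1}^*`, which is `0` if `i + 1` exceeds the weight of `α`. -/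
noncomputable def ghost (α : S) (i : ℕ) : E.Free R :=
  if h : i < E.weight α then letter E R (.ghost ⟨α, i, h⟩) else 0

end Free

open Free in
/-- The defining relations of the weighted Leavitt path algebra. As usual, for a graph that is not
row-finite the relation `sum_edge_ghost` is imposed only at vertices that emit finitely many
structured edges. The hypotheses `hi` and `hj` there say that both indices are at most the maximal
weight of the structured edges emitted by `v`. -/
inductive Rel : E.Free R → E.Free R → Prop
  | vertex_self (v : V) : Rel (vertex E R v * vertex E R v) (vertex E R v)
  | vertex_ne (v w : V) (h : v ≠ w) : Rel (vertex E R v * vertex E R w) 0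
  | source_edge (α : S) (i : ℕ) (hi : i < E.weight α) :
      Rel (vertex E R (E.source α) * edge E R α i) (edge E R α i)
  | edge_range (α : S) (i : ℕ) (hi : i < E.weight α) :
      Rel (edge E R α i * vertex E R (E.range α)) (edge E R α i)
  | range_ghost (α : S) (i : ℕ) (hi : i < E.weight α) :
      Rel (vertex E R (E.range α) * ghost E R α i) (ghost E R α i)
  | ghost_source (α : S) (i : ℕ) (hi : i < E.weight α) :
      Rel (ghost E R α i * vertex E R (E.source α)) (ghost E R α i)
  | sum_edge_ghost (v : V) (hv : {α | E.source α = v}.Finite) (i j : ℕ)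
      (hi : ∃ α, E.source α = v ∧ i < E.weight α) (hj : ∃ α, E.source α = v ∧ j < E.weight α) :
      Rel (∑ α ∈ hv.toFinset, edge E R α i * ghost E R α j) (if i = j then vertex E R v else 0)
  | sum_ghost_edge_self (α : S) :
      Rel (∑ i ∈ Finset.range (E.weight α), ghost E R α i * edge E R α i)
        (vertex E R (E.range α))
  | sum_ghost_edge_ne (α β : S) (h : α ≠ β) :
      Rel (∑ i ∈ Finset.range (max (E.weight α) (E.weight β)), ghost E R α i * edge E R β i) 0

/-- The relations multiplied by scalars, so that the ring congruence they generate is compatible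
with scalar multiplication (the free algebra has no unit). -/
inductive ScaledRel : E.Free R → E.Free R → Prop
  | smul (c : R) (x y : E.Free R) (h : Rel E R x y) : ScaledRel (c • x) (c • y)

/-- The congruence modulo the ideal of the free algebra generated by the relations. -/
noncomputable def relCon : RingCon (E.Free R) := ringConGen (E.ScaledRel R)

theorem relCon_smul (c : R) {x y : E.Free R} (h : E.relCon R x y) :
    E.relCon R (c • x) (c • y) := by
  change RingConGen.Rel _ _ _ at h
  change RingConGen.Rel _ _ _
  induction h with
  | of x y h =>
    obtain ⟨d, x, y, h⟩ := h
    rw [smul_smul, smul_smul]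
    exact .of _ _ (.smul _ _ _ h)
  | refl x => exact .refl _
  | symm _ ih => exact .symm ih
  | trans _ _ ih₁ ih₂ => exact .trans ih₁ ih₂
  | add _ _ ih₁ ih₂ => rw [smul_add, smul_add]; exact .add ih₁ ih₂
  | mul _ h₂ ih₁ _ => rw [← smul_mul_assoc, ← smul_mul_assoc]; exact .mul ih₁ h₂

/-- The weighted Leavitt path algebra `L_R(E, ω)`. -/
def LeavittPathAlgebra : Type (max u v w) := (E.relCon R).Quotient

namespace LeavittPathAlgebra

noncomputable instance : NonUnitalRing (E.LeavittPathAlgebra R) :=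
  inferInstanceAs (NonUnitalRing (E.relCon R).Quotient)

/-- The quotient map from the free algebra. -/
noncomputable def mk (x : E.Free R) : E.LeavittPathAlgebra R := (x : (E.relCon R).Quotient)

theorem mk_surjective : Function.Surjective (mk E R) := Quotient.mk''_surjective

theorem mk_eq {x y : E.Free R} : mk E R x = mk E R y ↔ E.relCon R x y := RingCon.eq _

noncomputable instance : SMul R (E.LeavittPathAlgebra R) where
  smul c := Quotient.map' (c • ·) fun _ _ h => relCon_smul E R c h

theorem mk_add (x y : E.Free R) : mk E R (x + y) = mk E R x + mk E R y := rfl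

theorem mk_mul (x y : E.Free R) : mk E R (x * y) = mk E R x * mk E R y := rfl

theorem mk_zero : mk E R 0 = 0 := rfl

theorem mk_smul (c : R) (x : E.Free R) : mk E R (c • x) = c • mk E R x := rfl

noncomputable instance : Module R (E.LeavittPathAlgebra R) :=
  Function.Surjective.module R
    ({ toFun := mk E R, map_zero' := mk_zero E R, map_add' := mk_add E R } :
      E.Free R →+ E.LeavittPathAlgebra R) (mk_surjective E R) (mk_smul E R)

instance : IsScalarTower R (E.LeavittPathAlgebra R) (E.LeavittPathAlgebra R) where
  smul_assoc c x y := by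
    obtain ⟨x, rfl⟩ := mk_surjective E R x
    obtain ⟨y, rfl⟩ := mk_surjective E R y
    simp only [smul_eq_mul, ← mk_smul, ← mk_mul, smul_mul_assoc]

instance : SMulCommClass R (E.LeavittPathAlgebra R) (E.LeavittPathAlgebra R) where
  smul_comm c x y := by
    obtain ⟨x, rfl⟩ := mk_surjective E R x
    obtain ⟨y, rfl⟩ := mk_surjective E R y
    simp only [smul_eq_mul, ← mk_smul, ← mk_mul, mul_smul_comm]

end LeavittPathAlgebra

section Grading

variable {E} {G : Type*} [AddCommGroup G] (deg : E.Edge → G)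

/-- The degree of a letter: `0` for vertices, `deg e` for an edge `e`, `-deg e` for `e^*`. -/
def genDegree : E.Gen → G
  | .vertex _ => 0
  | .edge e => deg e
  | .ghost e => -deg e

/-- The degree of a nonempty word: the sum of the degrees of its letters. -/
def wordDegree (x : FreeSemigroup E.Gen) : G :=
  ((x.head :: x.tail).map (genDegree deg)).sum

/-- The homogeneous component of degree `g` of `L_R(E, ω)` for the `G`-grading given by `deg`. -/
noncomputable def homogeneousComponent (g : G) : Submodule R (E.LeavittPathAlgebra R) :=
  Submodule.span R {a | ∃ x : FreeSemigroup E.Gen, wordDegree deg x = g ∧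
    a = LeavittPathAlgebra.mk E R (MonoidAlgebra.single x 1)}

/-- A two-sided ideal is graded if each of its elements is a sum of homogeneous elements of the
ideal. -/
def IsGradedIdeal (I : TwoSidedIdeal (E.LeavittPathAlgebra R)) : Prop :=
  ∀ a ∈ I, a ∈ AddSubgroup.closure {b | b ∈ I ∧ ∃ g, b ∈ homogeneousComponent R deg g}

/-- `L_R(E, ω)` is graded simple for the `G`-grading given by `deg`: it is nonzero, and `0` and
the whole algebra are its only graded two-sided ideals. -/
def IsGradedSimple : Prop :=
  Nontrivial (E.LeavittPathAlgebra R) ∧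
    ∀ I : TwoSidedIdeal (E.LeavittPathAlgebra R), IsGradedIdeal R deg I → I = ⊥ ∨ I = ⊤

end Grading

/-- The indices `i` of edges `α_{i+1}`: if the weights are bounded with maximum `n`, these are
`0, …, n - 1`. -/
abbrev WeightIndex : Type := {i : ℕ // ∃ α, i < E.weight α}

/-- The standard degree map, `deg(α_{i+1}) = e_{i+1}`, with values in the free abelian group on the
indices of edges. This group is `ℤ^n` if the weights have maximum `n`. -/
noncomputable def multidegree (e : E.Edge) : E.WeightIndex →₀ ℤ :=
  Finsupp.single ⟨e.2, e.1, e.2.isLt⟩ 1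

/-- The standard `ℤ`-valued degree map, for an unweighted graph: every edge has degree `1`. -/
def unitDegree (_ : E.Edge) : ℤ := 1

end WeightedGraph

/-! Suppose first that the graph is reducible. At a vertex of the weight forest `W` relation (3) has
a single summand and says `α_i α_j^* = δ_ij s(α)`, while (4) says `∑ α_i^* α_i = r(α)`. With edges
and ghost edges exchanged, these are the Leavitt relations for the reversed edges, because `r(α)`
receives no other structured edge from `W`. Outside `W` all weights are 1 and nothing changes. Hence
`L(E, ω) ≅ L(F)`, and the multidegree becomes a degree map on `F` that is `-e_i` on reversed edges
and `e_i` on the others.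

This grading of `L(F)` is not the standard one, but graded simplicity does not see the difference.
If nontrivial closed paths of a row-finite unweighted graph have nonzero degree, then every nonzero
graded ideal contains a nonzero vertex (`IsGradedIdeal.exists_p_mem`), and the ideal of a vertex is
graded for every degree map (`IsGradedSimple.change_degree`). In `F` no edge leaves `W`, so a closed
path consists of reversed edges only or of kept edges only, and its total degree is plus or minus
its length.

Conversely, let the algebra be graded simple. A homogeneous element that acts as zero in one nonzero
representation is zero (`IsGradedSimple.eq_zero_of_map_eq_zero`), hence acts as zero in all.
Irreducibility is refuted by a homogeneous element that vanishes in one representation and not in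
another. The representations have basis `V × ℕ` and come from bijections at each vertex between
pairs (index, number) and pairs (structured edge, number), which can be chosen with great freedom.
If a weighted vertex emits two structured edges, an edge of maximal weight need never be paired with
the first index. Otherwise a ghost path that starts its action at a weighted vertex hits an infinite
set of basis vectors with infinite complement. A permutation at its last edge moves this set into,
or partly out of, the vectors killed by another homogeneous element, and the product of the two is
the required element (`BranchingSystem.not_isGradedSimple_of_twist`). -/

namespace WeightedGraph

/-! ### Presentation and universal property -/

/-- Elements of a nonunital ring that satisfy the defining relations of the weighted Leavitt path
algebra; the index `i` in `x α i` and `y α i` starts at `0`. -/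
structure LeavittFamily {V : Type u} {S : Type v} (E : WeightedGraph V S)
    (A : Type*) [NonUnitalRing A] where
  p : V → A
  x : S → ℕ → A
  y : S → ℕ → A
  x_eq_zero : ∀ α i, E.weight α ≤ i → x α i = 0
  y_eq_zero : ∀ α i, E.weight α ≤ i → y α i = 0
  p_mul_self : ∀ v, p v * p v = p v
  p_mul_ne : ∀ v w, v ≠ w → p v * p w = 0
  p_mul_x : ∀ α i, p (E.source α) * x α i = x α i
  x_mul_p : ∀ α i, x α i * p (E.range α) = x α i
  p_mul_y : ∀ α i, p (E.range α) * y α i = y α i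
  y_mul_p : ∀ α i, y α i * p (E.source α) = y α i
  sum_x_mul_y : ∀ v (hv : {α | E.source α = v}.Finite) (i j : ℕ),
    (∃ α, E.source α = v ∧ i < E.weight α) → (∃ α, E.source α = v ∧ j < E.weight α) →
    ∑ α ∈ hv.toFinset, x α i * y α j = if i = j then p v else 0
  sum_y_mul_x_self : ∀ α, ∑ i ∈ Finset.range (E.weight α), y α i * x α i = p (E.range α)
  sum_y_mul_x_ne : ∀ α β, α ≠ β →
    ∑ i ∈ Finset.range (max (E.weight α) (E.weight β)), y α i * x β i = 0

namespace LeavittPathAlgebra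

variable {V : Type u} {S : Type v} (E : WeightedGraph V S) (R : Type w) [CommRing R]

/-- The quotient map from the free algebra as an algebra homomorphism. -/
noncomputable def mkHom : E.Free R →ₙₐ[R] E.LeavittPathAlgebra R where
  toFun := mk E R
  map_smul' := mk_smul E R
  map_zero' := mk_zero E R
  map_add' := mk_add E R
  map_mul' := mk_mul E R

theorem mkHom_apply (a : E.Free R) : mkHom E R a = mk E R a := rfl

theorem mk_eq_of_rel {a b : E.Free R} (h : Rel E R a b) : mk E R a = mk E R b := by
  rw [mk_eq]
  have := RingConGen.Rel.of (r := E.ScaledRel R) _ _ (.smul 1 a b h)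
  rwa [one_smul, one_smul] at this

/-- The family of standard generators of the weighted Leavitt path algebra. -/
noncomputable def family : LeavittFamily E (E.LeavittPathAlgebra R) where
  p v := mkHom E R (Free.vertex E R v)
  x α i := mkHom E R (Free.edge E R α i)
  y α i := mkHom E R (Free.ghost E R α i)
  x_eq_zero α i h := by rw [Free.edge, dif_neg h.not_gt, map_zero]
  y_eq_zero α i h := by rw [Free.ghost, dif_neg h.not_gt, map_zero]
  p_mul_self v := by
    rw [← map_mul]; exact mk_eq_of_rel E R (.vertex_self v)
  p_mul_ne v w h := by
    rw [← map_mul]; exact mk_eq_of_rel E R (.vertex_ne v w h)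
  p_mul_x α i := by
    by_cases h : i < E.weight α
    · rw [← map_mul]; exact mk_eq_of_rel E R (.source_edge α i h)
    · rw [Free.edge, dif_neg h, map_zero, mul_zero]
  x_mul_p α i := by
    by_cases h : i < E.weight α
    · rw [← map_mul]; exact mk_eq_of_rel E R (.edge_range α i h)
    · rw [Free.edge, dif_neg h, map_zero, zero_mul]
  p_mul_y α i := by
    by_cases h : i < E.weight α
    · rw [← map_mul]; exact mk_eq_of_rel E R (.range_ghost α i h)
    · rw [Free.ghost, dif_neg h, map_zero, mul_zero]
  y_mul_p α i := by
    by_cases h : i < E.weight α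
    · rw [← map_mul]; exact mk_eq_of_rel E R (.ghost_source α i h)
    · rw [Free.ghost, dif_neg h, map_zero, zero_mul]
  sum_x_mul_y v hv i j hi hj := by
    simp only [← map_mul, ← map_sum]
    refine (mk_eq_of_rel E R (.sum_edge_ghost v hv i j hi hj)).trans ?_
    split_ifs <;> rfl
  sum_y_mul_x_self α := by
    simp only [← map_mul, ← map_sum]
    exact mk_eq_of_rel E R (.sum_ghost_edge_self α)
  sum_y_mul_x_ne α β h := by
    simp only [← map_mul, ← map_sum]
    exact mk_eq_of_rel E R (.sum_ghost_edge_ne α β h)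

/-- A standard generator. -/
noncomputable def gen (g : E.Gen) : E.LeavittPathAlgebra R := mkHom E R (Free.letter E R g)

theorem gen_vertex (v : V) : gen E R (.vertex v) = (family E R).p v := rfl

theorem gen_edge (e : E.Edge) : gen E R (.edge e) = (family E R).x e.1 e.2 := by
  simp only [gen, family, Free.edge, dif_pos e.2.isLt]

theorem gen_ghost (e : E.Edge) : gen E R (.ghost e) = (family E R).y e.1 e.2 := by
  simp only [gen, family, Free.ghost, dif_pos e.2.isLt]

/-- The image of a word. -/
noncomputable def word (m : FreeSemigroup E.Gen) : E.LeavittPathAlgebra R :=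
  mkHom E R (MonoidAlgebra.single m 1)

theorem word_of (g : E.Gen) : word E R (.of g) = gen E R g := rfl

theorem word_mul (m n : FreeSemigroup E.Gen) : word E R (m * n) = word E R m * word E R n := by
  rw [word, word, word, ← map_mul, MonoidAlgebra.single_mul_single, one_mul]

theorem span_range_word : Submodule.span R (Set.range (word E R)) = ⊤ := by
  rw [eq_top_iff]
  rintro a -
  obtain ⟨a, rfl⟩ := mk_surjective E R a
  rw [← mkHom_apply]
  induction a using MonoidAlgebra.induction_linear with
  | zero => rw [map_zero]; exact zero_mem _
  | add f g hf hg => rw [map_add]; exact add_mem hf hg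
  | single m r =>
    have : MonoidAlgebra.single m r = r • (MonoidAlgebra.single m (1 : R)) := by
      rw [MonoidAlgebra.smul_single, smul_eq_mul, mul_one]
    rw [this, map_smul]
    exact Submodule.smul_mem _ _ (Submodule.subset_span ⟨m, rfl⟩)

section Lift

variable {E}
variable {A : Type*} [NonUnitalRing A] [Module R A] [IsScalarTower R A A] [SMulCommClass R A A]
variable (F : LeavittFamily E A)

/-- The image of a letter under the homomorphism defined by a family. -/
def liftGen : E.Gen → A
  | .vertex v => F.p v
  | .edge e => F.x e.1 e.2
  | .ghost e => F.y e.1 e.2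

/-- The homomorphism on the free algebra defined by a family. -/
noncomputable def freeLift : E.Free R →ₙₐ[R] A :=
  MonoidAlgebra.liftMagma R (FreeSemigroup.lift (liftGen F))

theorem freeLift_letter (g : E.Gen) : freeLift R F (Free.letter E R g) = liftGen F g := by
  simp [freeLift, Free.letter]

theorem freeLift_vertex (v : V) : freeLift R F (Free.vertex E R v) = F.p v :=
  freeLift_letter R F _

theorem freeLift_edge (α : S) (i : ℕ) : freeLift R F (Free.edge E R α i) = F.x α i := by
  unfold Free.edge
  split_ifs with h
  · exact freeLift_letter R F _
  · rw [map_zero, F.x_eq_zero _ _ (not_lt.1 h)]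

theorem freeLift_ghost (α : S) (i : ℕ) : freeLift R F (Free.ghost E R α i) = F.y α i := by
  unfold Free.ghost
  split_ifs with h
  · exact freeLift_letter R F _
  · rw [map_zero, F.y_eq_zero _ _ (not_lt.1 h)]

theorem freeLift_eq_of_rel {a b : E.Free R} (h : Rel E R a b) :
    freeLift R F a = freeLift R F b := by
  induction h with
  | vertex_self v => simp only [map_mul, freeLift_vertex, F.p_mul_self]
  | vertex_ne v w h => simp only [map_mul, map_zero, freeLift_vertex, F.p_mul_ne v w h]
  | source_edge α i hi => simp only [map_mul, freeLift_vertex, freeLift_edge, F.p_mul_x]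
  | edge_range α i hi => simp only [map_mul, freeLift_vertex, freeLift_edge, F.x_mul_p]
  | range_ghost α i hi => simp only [map_mul, freeLift_vertex, freeLift_ghost, F.p_mul_y]
  | ghost_source α i hi => simp only [map_mul, freeLift_vertex, freeLift_ghost, F.y_mul_p]
  | sum_edge_ghost v hv i j hi hj =>
    simp only [map_sum, map_mul, freeLift_edge, freeLift_ghost, F.sum_x_mul_y v hv i j hi hj]
    split_ifs
    · rw [freeLift_vertex]
    · rw [map_zero]
  | sum_ghost_edge_self α =>
    simp only [map_sum, map_mul, freeLift_edge, freeLift_ghost, freeLift_vertex,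
      F.sum_y_mul_x_self]
  | sum_ghost_edge_ne α β h =>
    simp only [map_sum, map_mul, freeLift_edge, freeLift_ghost, map_zero,
      F.sum_y_mul_x_ne α β h]

theorem freeLift_eq_of_relCon {a b : E.Free R} (h : E.relCon R a b) :
    freeLift R F a = freeLift R F b := by
  change RingConGen.Rel _ _ _ at h
  induction h with
  | of x y h =>
    obtain ⟨c, x, y, h⟩ := h
    rw [map_smul, map_smul, freeLift_eq_of_rel R F h]
  | refl x => rfl
  | symm _ ih => exact ih.symm
  | trans _ _ ih₁ ih₂ => exact ih₁.trans ih₂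
  | add _ _ ih₁ ih₂ => rw [map_add, map_add, ih₁, ih₂]
  | mul _ _ ih₁ ih₂ => rw [map_mul, map_mul, ih₁, ih₂]

/-- The homomorphism from the weighted Leavitt path algebra defined by a family. -/
noncomputable def lift : E.LeavittPathAlgebra R →ₙₐ[R] A where
  toFun := Quotient.lift (freeLift R F) fun _ _ h => freeLift_eq_of_relCon R F h
  map_smul' c a := by
    obtain ⟨a, rfl⟩ := mk_surjective E R a
    exact map_smul (freeLift R F) c a
  map_zero' := map_zero (freeLift R F)
  map_add' a b := by
    obtain ⟨a, rfl⟩ := mk_surjective E R a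
    obtain ⟨b, rfl⟩ := mk_surjective E R b
    exact map_add (freeLift R F) a b
  map_mul' a b := by
    obtain ⟨a, rfl⟩ := mk_surjective E R a
    obtain ⟨b, rfl⟩ := mk_surjective E R b
    exact map_mul (freeLift R F) a b

theorem lift_p (v : V) : lift R F ((family E R).p v) = F.p v := freeLift_vertex R F v

theorem lift_x (α : S) (i : ℕ) : lift R F ((family E R).x α i) = F.x α i := freeLift_edge R F α i

theorem lift_y (α : S) (i : ℕ) : lift R F ((family E R).y α i) = F.y α i := freeLift_ghost R F α i

end Lift

variable {E R} in
theorem hom_ext {A : Type*} [NonUnitalRing A] [Module R A] {f g : E.LeavittPathAlgebra R →ₙₐ[R] A}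
    (h : ∀ a, f (gen E R a) = g (gen E R a)) : f = g := by
  ext a
  have ha : a ∈ Submodule.span R (Set.range (word E R)) := by
    rw [span_range_word]; exact Submodule.mem_top
  induction ha using Submodule.span_induction with
  | mem a ha =>
    obtain ⟨m, rfl⟩ := ha
    induction m using FreeSemigroup.recOnMul with
    | ih1 m => exact h m
    | ih2 m n hm hn => rw [word_mul, map_mul, map_mul, hm, hn]
  | zero => rw [map_zero, map_zero]
  | add a b _ _ ha hb => rw [map_add, map_add, ha, hb]
  | smul c a _ ha => rw [map_smul, map_smul, ha]

end LeavittPathAlgebra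

/-! ### Homogeneous components and graded ideals -/

section Grading

open LeavittPathAlgebra

variable {V : Type u} {S : Type v} {E : WeightedGraph V S} (R : Type w) [CommRing R]
variable {G : Type*} [AddCommGroup G] (deg : E.Edge → G)

theorem wordDegree_of (g : E.Gen) : wordDegree deg (.of g) = genDegree deg g := by
  simp [wordDegree, FreeSemigroup.of]

theorem wordDegree_mul (m n : FreeSemigroup E.Gen) :
    wordDegree deg (m * n) = wordDegree deg m + wordDegree deg n := by
  simp [wordDegree, add_assoc]

theorem word_mem (m : FreeSemigroup E.Gen) :
    word E R m ∈ homogeneousComponent R deg (wordDegree deg m) :=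
  Submodule.subset_span ⟨m, rfl, rfl⟩

theorem gen_mem (g : E.Gen) : gen E R g ∈ homogeneousComponent R deg (genDegree deg g) := by
  rw [← wordDegree_of, ← word_of]
  exact word_mem R deg _

theorem family_p_mem (v : V) : (family E R).p v ∈ homogeneousComponent R deg 0 :=
  gen_mem R deg (.vertex v)

theorem family_x_mem (e : E.Edge) :
    (family E R).x e.1 e.2 ∈ homogeneousComponent R deg (deg e) := by
  rw [← gen_edge]; exact gen_mem R deg (.edge e)

theorem family_y_mem (e : E.Edge) :
    (family E R).y e.1 e.2 ∈ homogeneousComponent R deg (-deg e) := by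
  rw [← gen_ghost]; exact gen_mem R deg (.ghost e)

theorem mul_mem_homogeneousComponent {g h : G} {a b : E.LeavittPathAlgebra R}
    (ha : a ∈ homogeneousComponent R deg g) (hb : b ∈ homogeneousComponent R deg h) :
    a * b ∈ homogeneousComponent R deg (g + h) := by
  induction ha using Submodule.span_induction with
  | mem a ha =>
    obtain ⟨m, rfl, rfl⟩ := ha
    induction hb using Submodule.span_induction with
    | mem b hb =>
      obtain ⟨n, rfl, rfl⟩ := hb
      rw [← wordDegree_mul]
      change word E R m * word E R n ∈ _
      rw [← word_mul]
      exact word_mem R deg _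
    | zero => rw [mul_zero]; exact zero_mem _
    | add a b _ _ ha hb => rw [mul_add]; exact add_mem ha hb
    | smul c a _ ha => rw [mul_smul_comm]; exact Submodule.smul_mem _ _ ha
  | zero => rw [zero_mul]; exact zero_mem _
  | add a b _ _ ha hb => rw [add_mul]; exact add_mem ha hb
  | smul c a _ ha => rw [smul_mul_assoc]; exact Submodule.smul_mem _ _ ha

/-- The weighted Leavitt path algebra is the sum of its homogeneous components. -/
theorem mem_closure_homogeneous (a : E.LeavittPathAlgebra R) :
    a ∈ AddSubgroup.closure {b | ∃ g, b ∈ homogeneousComponent R deg g} := by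
  have ha : a ∈ Submodule.span R (Set.range (word E R)) := by
    rw [span_range_word]; exact Submodule.mem_top
  -- The span is the additive closure of the scalar multiples of words, each of which is
  -- homogeneous.
  rw [← Submodule.mem_toAddSubmonoid, Submodule.span_eq_closure] at ha
  revert a
  change AddSubmonoid.closure _ ≤ (AddSubgroup.closure _).toAddSubmonoid
  rw [AddSubmonoid.closure_le]
  rintro _ ⟨c, -, _, ⟨m, rfl⟩, rfl⟩
  exact AddSubgroup.subset_closure ⟨_, Submodule.smul_mem _ _ (word_mem R deg m)⟩

/-- The ideal generated by a homogeneous element is graded. -/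
theorem isGradedIdeal_span_singleton {g : G} {a : E.LeavittPathAlgebra R}
    (ha : a ∈ homogeneousComponent R deg g) :
    IsGradedIdeal R deg (TwoSidedIdeal.span {a}) := by
  set I := TwoSidedIdeal.span {a} with hI
  set C := AddSubgroup.closure {b | b ∈ I ∧ ∃ g, b ∈ homogeneousComponent R deg g} with hC
  -- `C` is an ideal: `C` and the whole algebra are additively generated by homogeneous elements,
  -- and products of these are homogeneous. As `C` contains `a`, it contains `I`.
  have key : ∀ b ∈ C, ∀ r, r * b ∈ C ∧ b * r ∈ C := by
    intro b hb r
    have hr := mem_closure_homogeneous R deg r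
    induction hb using AddSubgroup.closure_induction with
    | mem b hb =>
      obtain ⟨hbI, h, hbh⟩ := hb
      induction hr using AddSubgroup.closure_induction with
      | mem r hr =>
        obtain ⟨k, hk⟩ := hr
        exact ⟨AddSubgroup.subset_closure ⟨I.mul_mem_left _ _ hbI, _,
            mul_mem_homogeneousComponent R deg hk hbh⟩,
          AddSubgroup.subset_closure ⟨I.mul_mem_right _ _ hbI, _,
            mul_mem_homogeneousComponent R deg hbh hk⟩⟩
      | zero => simp [zero_mem]
      | add r s _ _ hr hs =>
        rw [add_mul, mul_add]; exact ⟨add_mem hr.1 hs.1, add_mem hr.2 hs.2⟩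
      | neg r _ hr => rw [neg_mul, mul_neg]; exact ⟨neg_mem hr.1, neg_mem hr.2⟩
    | zero => simp [zero_mem]
    | add b c _ _ hb hc =>
      rw [add_mul, mul_add]; exact ⟨add_mem hb.1 hc.1, add_mem hb.2 hc.2⟩
    | neg b _ hb => rw [neg_mul, mul_neg]; exact ⟨neg_mem hb.1, neg_mem hb.2⟩
  have hle : I ≤ TwoSidedIdeal.mk' (C : Set (E.LeavittPathAlgebra R)) (zero_mem C)
      (fun h k => add_mem h k) (fun h => neg_mem h) (fun {r b} h => (key b h r).1)
      (fun {b r} h => (key b h r).2) := by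
    rw [hI, TwoSidedIdeal.span_le, Set.singleton_subset_iff, TwoSidedIdeal.coe_mk']
    exact AddSubgroup.subset_closure ⟨TwoSidedIdeal.subset_span rfl, g, ha⟩
  intro b hb
  have := hle hb
  rwa [TwoSidedIdeal.mem_mk'] at this

/-- A nonzero graded ideal contains a nonzero homogeneous element. -/
theorem IsGradedIdeal.exists_homogeneous_ne_zero {I : TwoSidedIdeal (E.LeavittPathAlgebra R)}
    (hI : IsGradedIdeal R deg I) (h : I ≠ ⊥) :
    ∃ g, ∃ a ∈ homogeneousComponent R deg g, a ∈ I ∧ a ≠ 0 := by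
  by_contra! hn
  refine h (TwoSidedIdeal.ext fun a => ⟨fun ha => ?_, fun ha => ?_⟩)
  · have : AddSubgroup.closure {b | b ∈ I ∧ ∃ g, b ∈ homogeneousComponent R deg g} ≤ ⊥ := by
      rw [AddSubgroup.closure_le]
      rintro b ⟨hb, g, hg⟩
      exact hn g b hg hb
    exact (TwoSidedIdeal.mem_bot _).2 (AddSubgroup.mem_bot.1 (this (hI a ha)))
  · rw [(TwoSidedIdeal.mem_bot _).1 ha]
    exact I.zero_mem

variable {R deg} in
/-- A homogeneous element of a graded simple algebra which is not zero cannot vanish under a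
nonzero homomorphism. -/
theorem IsGradedSimple.eq_zero_of_map_eq_zero (hs : IsGradedSimple R deg) {g : G}
    {a b : E.LeavittPathAlgebra R} (ha : a ∈ homogeneousComponent R deg g)
    {A : Type*} [NonUnitalRing A] [Module R A]
    (f : E.LeavittPathAlgebra R →ₙₐ[R] A) (hfa : f a = 0) (hfb : f b ≠ 0) : a = 0 := by
  rcases hs.2 _ (isGradedIdeal_span_singleton R deg ha) with h | h
  · rw [← TwoSidedIdeal.mem_bot, ← h]
    exact TwoSidedIdeal.subset_span rfl
  · refine absurd ?_ hfb
    have hle : TwoSidedIdeal.span {a} ≤ TwoSidedIdeal.ker f := by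
      rw [TwoSidedIdeal.span_le, Set.singleton_subset_iff]
      exact (TwoSidedIdeal.mem_ker _).2 hfa
    rw [h] at hle
    exact (TwoSidedIdeal.mem_ker _).1 (hle trivial)

end Grading

/-! ### Invariance under graded isomorphisms -/

section Transfer

open LeavittPathAlgebra

variable {V V' : Type*} {S S' : Type*} {E : WeightedGraph V S} {F : WeightedGraph V' S'}
  {R : Type*} [CommRing R] {G : Type*} [AddCommGroup G] {deg : E.Edge → G} {deg' : F.Edge → G}

theorem map_mem_homogeneousComponent (f : E.LeavittPathAlgebra R →ₙₐ[R] F.LeavittPathAlgebra R)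
    (hf : ∀ x, f (gen E R x) ∈ homogeneousComponent R deg' (genDegree deg x))
    {g : G} {a : E.LeavittPathAlgebra R} (ha : a ∈ homogeneousComponent R deg g) :
    f a ∈ homogeneousComponent R deg' g := by
  induction ha using Submodule.span_induction with
  | mem a ha =>
    obtain ⟨m, rfl, rfl⟩ := ha
    change f (word E R m) ∈ _
    induction m using FreeSemigroup.recOnMul with
    | ih1 m => rw [wordDegree_of]; exact hf m
    | ih2 m n hm hn =>
      rw [word_mul, map_mul, wordDegree_mul]
      exact mul_mem_homogeneousComponent R deg' hm hn
  | zero => rw [map_zero]; exact zero_mem _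
  | add a b _ _ ha hb => rw [map_add]; exact add_mem ha hb
  | smul c a _ ha => rw [map_smul]; exact Submodule.smul_mem _ _ ha

/-- Graded simplicity is invariant under graded isomorphisms. -/
theorem IsGradedSimple.of_inverse (f : E.LeavittPathAlgebra R →ₙₐ[R] F.LeavittPathAlgebra R)
    (k : F.LeavittPathAlgebra R →ₙₐ[R] E.LeavittPathAlgebra R)
    (hfk : ∀ b, f (k b) = b) (hkf : ∀ a, k (f a) = a)
    (hk : ∀ x, k (gen F R x) ∈ homogeneousComponent R deg (genDegree deg' x))
    (hs : IsGradedSimple R deg) : IsGradedSimple R deg' := by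
  refine ⟨?_, fun I hI => ?_⟩
  · have := hs.1
    exact (Function.LeftInverse.injective hkf).nontrivial
  -- A homogeneous decomposition of `f a` inside `I` is carried back by `k`, which preserves
  -- degrees.
  · have hgr : IsGradedIdeal R deg (TwoSidedIdeal.comap f I) := by
      intro a ha
      have h := hI (f a) ((TwoSidedIdeal.mem_comap f).1 ha)
      rw [← hkf a]
      generalize f a = b at h
      induction h using AddSubgroup.closure_induction with
      | mem b hb =>
        obtain ⟨hb, g, hg⟩ := hb
        refine AddSubgroup.subset_closure ⟨?_, g, map_mem_homogeneousComponent k hk hg⟩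
        rw [TwoSidedIdeal.mem_comap, hfk]
        exact hb
      | zero => rw [map_zero]; exact zero_mem _
      | add b c _ _ hb hc => rw [map_add]; exact add_mem hb hc
      | neg b _ hb => rw [map_neg]; exact neg_mem hb
    rcases hs.2 _ hgr with h | h
    · refine Or.inl (TwoSidedIdeal.ext fun b => ?_)
      rw [TwoSidedIdeal.mem_bot, ← hfk b, ← TwoSidedIdeal.mem_comap f, h, TwoSidedIdeal.mem_bot]
      exact ⟨fun h => by rw [h, map_zero], fun h => by rw [← hkf (k b), h, map_zero]⟩
    · refine Or.inr (TwoSidedIdeal.ext fun b => ?_)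
      rw [← hfk b, ← TwoSidedIdeal.mem_comap f, h]
      exact ⟨fun _ => trivial, fun _ => trivial⟩

end Transfer

end WeightedGraph

namespace WeightedGraph

/-! ### Paths and ghost paths in a Leavitt family -/

section Family

variable {V : Type u} {S : Type v} {E : WeightedGraph V S} {A : Type*} [NonUnitalRing A]
  (F : LeavittFamily E A)

namespace LeavittFamily

theorem p_mul_x_ne {v : V} {α : S} (i : ℕ) (h : v ≠ E.source α) : F.p v * F.x α i = 0 := by
  rw [← F.p_mul_x, ← mul_assoc, F.p_mul_ne _ _ h, zero_mul]

theorem p_mul_y_ne {v : V} {α : S} (i : ℕ) (h : v ≠ E.range α) : F.p v * F.y α i = 0 := by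
  rw [← F.p_mul_y, ← mul_assoc, F.p_mul_ne _ _ h, zero_mul]

theorem x_mul_p_ne {v : V} {α : S} (i : ℕ) (h : E.range α ≠ v) : F.x α i * F.p v = 0 := by
  rw [← F.x_mul_p, mul_assoc, F.p_mul_ne _ _ h, mul_zero]

theorem y_mul_p_ne {v : V} {α : S} (i : ℕ) (h : E.source α ≠ v) : F.y α i * F.p v = 0 := by
  rw [← F.y_mul_p, mul_assoc, F.p_mul_ne _ _ h, mul_zero]

theorem y_mul_x_self {α : S} (h : E.weight α = 1) : F.y α 0 * F.x α 0 = F.p (E.range α) := by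
  have := F.sum_y_mul_x_self α
  rwa [h, Finset.sum_range_one] at this

theorem y_mul_x_ne {α β : S} (hα : E.weight α = 1) (hβ : E.weight β = 1) (h : α ≠ β) :
    F.y α 0 * F.x β 0 = 0 := by
  have := F.sum_y_mul_x_ne α β h
  rwa [hα, hβ, max_self, Finset.sum_range_one] at this

theorem sum_x_mul_y_self (hE : E.RowFinite) {v : V} (h : ∃ α, E.source α = v) :
    ∑ α ∈ (hE v).toFinset, F.x α 0 * F.y α 0 = F.p v := by
  obtain ⟨α, hα⟩ := h
  rw [F.sum_x_mul_y v (hE v) 0 0 ⟨α, hα, E.weight_pos α⟩ ⟨α, hα, E.weight_pos α⟩, if_pos rfl]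

end LeavittFamily

/-- `l` is the sequence of edges of a directed path from `a` to `b`. -/
def IsPath (E : WeightedGraph V S) : V → List S → V → Prop
  | a, [], b => a = b
  | a, e :: l, b => E.source e = a ∧ IsPath E (E.range e) l b

namespace LeavittFamily

/-- The path with edges `l` that ends in `b`, as an element of the algebra; all its edges carry
the index `0`. -/
def path : List S → V → A
  | [], b => F.p b
  | e :: l, b => F.x e 0 * path l b

/-- The ghost path of the path with edges `l` that ends in `b`. -/
def ghostPath : List S → V → A
  | [], b => F.p b
  | e :: l, b => ghostPath l b * F.y e 0

theorem path_mul_p (l : List S) (b : V) : F.path l b * F.p b = F.path l b := by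
  induction l with
  | nil => exact F.p_mul_self b
  | cons e l ih => rw [path, mul_assoc, ih]

theorem p_mul_ghostPath (l : List S) (b : V) : F.p b * F.ghostPath l b = F.ghostPath l b := by
  induction l with
  | nil => exact F.p_mul_self b
  | cons e l ih => rw [ghostPath, ← mul_assoc, ih]

theorem p_mul_path {a : V} {l : List S} {b : V} (h : E.IsPath a l b) :
    F.p a * F.path l b = F.path l b := by
  cases l with
  | nil => obtain rfl := h; exact F.p_mul_self _
  | cons e l => obtain ⟨rfl, h⟩ := h; rw [path, ← mul_assoc, F.p_mul_x]

theorem ghostPath_mul_p {a : V} {l : List S} {b : V} (h : E.IsPath a l b) :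
    F.ghostPath l b * F.p a = F.ghostPath l b := by
  cases l with
  | nil => obtain rfl := h; exact F.p_mul_self _
  | cons e l => obtain ⟨rfl, h⟩ := h; rw [ghostPath, mul_assoc, F.y_mul_p]

theorem path_append_singleton (l : List S) (e : S) :
    F.path l (E.source e) * F.x e 0 = F.path (l ++ [e]) (E.range e) := by
  induction l with
  | nil => simp only [List.nil_append, path, F.p_mul_x, F.x_mul_p]
  | cons f l ih => rw [path, mul_assoc, ih]; rfl

theorem ghostPath_append_singleton (l : List S) (e : S) :
    F.y e 0 * F.ghostPath l (E.source e) = F.ghostPath (l ++ [e]) (E.range e) := by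
  induction l with
  | nil => simp only [List.nil_append, ghostPath, F.y_mul_p, F.p_mul_y]
  | cons f l ih => rw [ghostPath, ← mul_assoc, ih]; rfl

end LeavittFamily

theorem IsPath.append_singleton {a : V} {l : List S} {e : S} (h : E.IsPath a l (E.source e)) :
    E.IsPath a (l ++ [e]) (E.range e) := by
  induction l generalizing a with
  | nil => exact ⟨h.symm, rfl⟩
  | cons f l ih => exact ⟨h.1, ih h.2⟩

end Family

/-! ### Unweighted graphs: calculus of the monomials `p q^*` -/

section Unweighted

open LeavittPathAlgebra

variable {V : Type u} {S : Type v} {E : WeightedGraph V S} {A : Type*} [NonUnitalRing A]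
  (F : LeavittFamily E A) {G : Type*} [AddCommGroup G] (deg : S → G)

theorem LeavittFamily.ghostPath_mul_path_self (h1 : ∀ e, E.weight e = 1) {a : V} {l : List S}
    {b : V} (h : E.IsPath a l b) : F.ghostPath l b * F.path l b = F.p b := by
  induction l generalizing a with
  | nil => exact F.p_mul_self b
  | cons e l ih =>
    rw [LeavittFamily.ghostPath, LeavittFamily.path, mul_assoc, ← mul_assoc (F.y e 0),
      F.y_mul_x_self (h1 e), F.p_mul_path h.2, ih h.2]

/-- Distinct paths of the same degree that end at the same vertex are orthogonal if closed paths of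
degree `0` are trivial. -/
theorem LeavittFamily.ghostPath_mul_path_ne (h1 : ∀ e, E.weight e = 1)
    (hd : ∀ a l, E.IsPath a l a → (l.map deg).sum = 0 → l = [])
    {a a' b : V} {l m : List S} (hl : E.IsPath a l b) (hm : E.IsPath a' m b)
    (hlm : (l.map deg).sum = (m.map deg).sum) (hne : l ≠ m) :
    F.ghostPath l b * F.path m b = 0 := by
  induction l generalizing a a' m with
  | nil =>
    obtain rfl := hl
    -- All edges of the first path are cancelled. What remains of the second has degree 0, and it is
    -- closed if it starts at the common endpoint.
    by_cases h : a' = a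
    · subst h
      exact absurd (hd _ _ hm hlm.symm).symm hne
    · rw [LeavittFamily.ghostPath, ← F.p_mul_path hm, ← mul_assoc,
        F.p_mul_ne _ _ (Ne.symm h), zero_mul]
  | cons e l ih =>
    cases m with
    | nil =>
      obtain rfl := hm
      by_cases h : a = a'
      · subst h
        exact absurd (hd _ _ hl hlm) hne
      · rw [LeavittFamily.path, ← F.ghostPath_mul_p hl, mul_assoc, F.p_mul_ne _ _ h, mul_zero]
    | cons f m =>
      rw [LeavittFamily.ghostPath, LeavittFamily.path, mul_assoc, ← mul_assoc (F.y e 0)]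
      by_cases h : e = f
      · subst h
        rw [F.y_mul_x_self (h1 e), F.p_mul_path hm.2]
        refine ih hl.2 hm.2 ?_ fun h => hne (by rw [h])
        simpa using hlm
      · rw [F.y_mul_x_ne (h1 e) (h1 f) h, zero_mul, mul_zero]

/-- The elements `p q^*` for paths `p` and `q` with `deg p - deg q = g`, where `q` starts at `a`
and has length at most `n`. -/
def LeavittFamily.monomials (g : G) (a : V) (n : ℕ) : Set A :=
  {c | ∃ b' l m b, E.IsPath b' l b ∧ E.IsPath a m b ∧ m.length ≤ n ∧
    (l.map deg).sum - (m.map deg).sum = g ∧ c = F.path l b * F.ghostPath m b}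

namespace LeavittFamily

variable {F deg}

theorem p_mem_monomials (a : V) (n : ℕ) : F.p a ∈ F.monomials deg 0 a n :=
  ⟨a, [], [], a, rfl, rfl, Nat.zero_le n, by simp, (F.p_mul_self a).symm⟩

theorem monomials_mul_p {g : G} {a : V} {n : ℕ} {c : A} (hc : c ∈ F.monomials deg g a n) :
    c * F.p a = c := by
  obtain ⟨b', l, m, b, hl, hm, -, -, rfl⟩ := hc
  rw [mul_assoc, F.ghostPath_mul_p hm]

theorem p_mul_monomials {g : G} {a : V} {n : ℕ} {c : A} (hc : c ∈ F.monomials deg g a n)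
    (v : V) : F.p v * c = 0 ∨ F.p v * c ∈ F.monomials deg g a n := by
  obtain ⟨b', l, m, b, hl, hm, hn, hg, rfl⟩ := hc
  rw [← mul_assoc, ← F.p_mul_path hl, ← mul_assoc]
  by_cases h : v = b'
  · subst h
    rw [F.p_mul_self, F.p_mul_path hl]
    exact Or.inr ⟨v, l, m, b, hl, hm, hn, hg, rfl⟩
  · rw [F.p_mul_ne _ _ h, zero_mul, zero_mul]
    exact Or.inl rfl

theorem x_mul_monomials {g : G} {a : V} {n : ℕ} {c : A} (hc : c ∈ F.monomials deg g a n)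
    (e : S) : F.x e 0 * c = 0 ∨ F.x e 0 * c ∈ F.monomials deg (deg e + g) a n := by
  obtain ⟨b', l, m, b, hl, hm, hn, rfl, rfl⟩ := hc
  by_cases h : E.range e = b'
  · subst h
    refine Or.inr ⟨_, e :: l, m, b, ⟨rfl, hl⟩, hm, hn, ?_, ?_⟩
    · rw [List.map_cons, List.sum_cons]; abel
    · rw [path, mul_assoc]
  · rw [← mul_assoc, ← F.p_mul_path hl, ← mul_assoc, F.x_mul_p_ne _ h, zero_mul, zero_mul]
    exact Or.inl rfl

/-- A ghost edge either meets the first edge of `p`, and cancels it or gives zero, or meets a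
trivial `p` and lengthens the ghost part. The second case is the reason for the bound `n + 1`. -/
theorem y_mul_monomials (h1 : ∀ e, E.weight e = 1) {g : G} {a : V} {n : ℕ} {c : A}
    (hc : c ∈ F.monomials deg g a n) (e : S) :
    F.y e 0 * c = 0 ∨ F.y e 0 * c ∈ F.monomials deg (-deg e + g) a (n + 1) := by
  obtain ⟨b', l, m, b, hl, hm, hn, rfl, rfl⟩ := hc
  cases l with
  | nil =>
    obtain rfl := hl
    by_cases h : E.source e = b'
    · subst h
      refine Or.inr ⟨_, [], m ++ [e], E.range e, rfl, hm.append_singleton, by simpa using hn,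
        ?_, ?_⟩
      · simp only [List.map_append, List.map_cons, List.map_nil, List.sum_append, List.sum_nil,
          List.sum_cons]
        abel
      · rw [path, F.p_mul_ghostPath, path, F.p_mul_ghostPath, F.ghostPath_append_singleton]
    · rw [path, ← mul_assoc, F.y_mul_p_ne _ h, zero_mul]
      exact Or.inl rfl
  | cons f l =>
    rw [path, ← mul_assoc, ← mul_assoc]
    by_cases h : e = f
    · subst h
      refine Or.inr ⟨_, l, m, b, hl.2, hm, hn.trans n.le_succ, ?_, ?_⟩
      · rw [List.map_cons, List.sum_cons]; abel
      · rw [F.y_mul_x_self (h1 e), F.p_mul_path hl.2]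
    · rw [F.y_mul_x_ne (h1 e) (h1 f) h, zero_mul, zero_mul]
      exact Or.inl rfl

/-- The edge cancels the ghost factor next to it or gives zero, so the ghost part gets shorter; a
trivial ghost part stays trivial while `p` grows. This drives the removal of ghost edges from
elements of an ideal. -/
theorem monomials_mul_x (h1 : ∀ e, E.weight e = 1) {g : G} {n : ℕ} {c : A} {e : S}
    (hc : c ∈ F.monomials deg g (E.source e) (n + 1)) :
    c * F.x e 0 = 0 ∨ c * F.x e 0 ∈ F.monomials deg (g + deg e) (E.range e) n := by
  obtain ⟨b', l, m, b, hl, hm, hn, rfl, rfl⟩ := hc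
  cases m with
  | nil =>
    obtain rfl := hm
    refine Or.inr ⟨b', l ++ [e], [], _, hl.append_singleton, rfl, Nat.zero_le n, ?_, ?_⟩
    · simp
    · rw [ghostPath, ghostPath, F.path_mul_p, F.path_mul_p, F.path_append_singleton]
  | cons f m =>
    rw [ghostPath, mul_assoc, mul_assoc]
    by_cases h : f = e
    · subst h
      refine Or.inr ⟨b', l, m, b, hl, hm.2, Nat.succ_le_succ_iff.1 hn, ?_, ?_⟩
      · rw [List.map_cons, List.sum_cons]; abel
      · rw [F.y_mul_x_self (h1 f), F.ghostPath_mul_p hm.2]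
    · rw [F.y_mul_x_ne (h1 f) (h1 e) h, mul_zero, mul_zero]
      exact Or.inl rfl

theorem monomials_mono {g : G} {a : V} {n n' : ℕ} (h : n ≤ n') :
    F.monomials deg g a n ⊆ F.monomials deg g a n' := by
  rintro _ ⟨b', l, m, b, hl, hm, hn, hg, rfl⟩
  exact ⟨b', l, m, b, hl, hm, hn.trans h, hg, rfl⟩

end LeavittFamily

end Unweighted

/-! ### Graded ideals contain vertices; independence of the grading -/

section Reduction

open LeavittPathAlgebra

variable {V : Type u} {S : Type v} {E : WeightedGraph V S} {G : Type*} [AddCommGroup G]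

/-- The degree of the edge `e_1` for a structured edge `e`. -/
def firstDegree (deg : E.Edge → G) (e : S) : G := deg ⟨e, 0, E.weight_pos e⟩

theorem edge_eq_first (h1 : ∀ e, E.weight e = 1) (e : E.Edge) :
    e = ⟨e.1, 0, E.weight_pos e.1⟩ := by
  obtain ⟨e, i, hi⟩ := e
  have := h1 e
  obtain rfl : i = 0 := by omega
  rfl

variable (R : Type w) (deg : E.Edge → G)

theorem gen_mul_monomials [CommRing R] (h1 : ∀ e, E.weight e = 1) {g : G} {a : V} {n : ℕ}
    {c : E.LeavittPathAlgebra R} (hc : c ∈ (family E R).monomials (firstDegree deg) g a n)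
    (z : E.Gen) : gen E R z * c = 0 ∨
      gen E R z * c ∈ (family E R).monomials (firstDegree deg) (genDegree deg z + g) a (n + 1) := by
  cases z with
  | vertex v =>
    rw [gen_vertex, genDegree, zero_add]
    exact (LeavittFamily.p_mul_monomials hc v).imp_right
      fun h => LeavittFamily.monomials_mono n.le_succ h
  | edge e =>
    rw [edge_eq_first h1 e, gen_edge]
    exact (LeavittFamily.x_mul_monomials hc e.1).imp_right
      fun h => LeavittFamily.monomials_mono n.le_succ h
  | ghost e =>
    rw [edge_eq_first h1 e, gen_ghost]
    exact LeavittFamily.y_mul_monomials h1 hc e.1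

theorem exists_gen_mul_p [CommRing R] (z : E.Gen) :
    ∃ a, gen E R z * (family E R).p a = gen E R z := by
  cases z with
  | vertex v => exact ⟨v, (family E R).p_mul_self v⟩
  | edge e => exact ⟨E.range e.1, by rw [gen_edge, LeavittFamily.x_mul_p]⟩
  | ghost e => exact ⟨E.source e.1, by rw [gen_ghost, LeavittFamily.y_mul_p]⟩

theorem exists_word_mul_p [CommRing R] (m : FreeSemigroup E.Gen) :
    ∃ a, word E R m * (family E R).p a = word E R m := by
  induction m using FreeSemigroup.recOnMul with
  | ih1 z => exact exists_gen_mul_p R z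
  | ih2 z m _ hm =>
    obtain ⟨a, ha⟩ := hm
    exact ⟨a, by rw [word_mul, mul_assoc, ha]⟩

/-- The sums of finitely many vertices are local units. -/
theorem exists_finset_sum_mul_p [CommRing R] (c : E.LeavittPathAlgebra R) :
    ∃ T : Finset V, ∀ T', T ⊆ T' → ∑ a ∈ T', c * (family E R).p a = c := by
  classical
  have hc : c ∈ Submodule.span R (Set.range (word E R)) := by
    rw [span_range_word]; exact Submodule.mem_top
  induction hc using Submodule.span_induction with
  | mem c hc =>
    obtain ⟨m, rfl⟩ := hc
    obtain ⟨a, ha⟩ := exists_word_mul_p R m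
    refine ⟨{a}, fun T' hT => ?_⟩
    rw [Finset.sum_eq_single a, ha]
    · intro b _ hb
      rw [← ha, mul_assoc, (family E R).p_mul_ne _ _ hb.symm, mul_zero]
    · exact fun h => absurd (hT (Finset.mem_singleton_self a)) h
  | zero => exact ⟨∅, fun T' _ => by simp⟩
  | add c d _ _ hc hd =>
    obtain ⟨T, hT⟩ := hc
    obtain ⟨U, hU⟩ := hd
    refine ⟨T ∪ U, fun T' h => ?_⟩
    simp only [add_mul, Finset.sum_add_distrib]
    rw [hT _ (Finset.union_subset_left h), hU _ (Finset.union_subset_right h)]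
  | smul r c _ hc =>
    obtain ⟨T, hT⟩ := hc
    refine ⟨T, fun T' h => ?_⟩
    simp only [smul_mul_assoc, ← Finset.smul_sum]
    rw [hT _ h]

/-- Words are built from the right, one letter at a time: a letter times a monomial `p q^*` is again
zero or a monomial. The start is the vertex at the right end of the last letter. -/
theorem word_mem_monomials [CommRing R] (h1 : ∀ e, E.weight e = 1) (m : FreeSemigroup E.Gen) :
    word E R m = 0 ∨
      ∃ a n, word E R m ∈ (family E R).monomials (firstDegree deg) (wordDegree deg m) a n := by
  induction m using FreeSemigroup.recOnMul with
  | ih1 z =>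
    obtain ⟨a, ha⟩ := exists_gen_mul_p R z
    have := gen_mul_monomials R deg h1 (LeavittFamily.p_mem_monomials a 0) z
    rw [ha, add_zero, ← wordDegree_of] at this
    exact this.imp_right fun h => ⟨a, _, h⟩
  | ih2 z m _ hm =>
    rw [word_mul, word_of, wordDegree_mul, wordDegree_of]
    rcases hm with hm | ⟨a, n, hm⟩
    · exact Or.inl (by rw [hm, mul_zero])
    · exact (gen_mul_monomials R deg h1 hm z).imp_right fun h => ⟨a, _, h⟩

variable {R deg}

theorem span_map_of_maps {A : Type*} [AddCommGroup A] [CommRing R] [Module R A] {s t : Set A}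
    (f : A →ₗ[R] A) (h : ∀ c ∈ s, f c = 0 ∨ f c ∈ t) {a : A} (ha : a ∈ Submodule.span R s) :
    f a ∈ Submodule.span R t := by
  have : Submodule.span R s ≤ (Submodule.span R t).comap f := by
    rw [Submodule.span_le]
    intro c hc
    rcases h c hc with h | h
    · rw [SetLike.mem_coe, Submodule.mem_comap, h]; exact zero_mem _
    · exact Submodule.subset_span h
  exact this ha

/-- An ideal with a nonzero homogeneous element contains a nonzero homogeneous combination of
monomials whose ghost parts start at the same vertex and have bounded length. -/
theorem exists_mem_span_monomials [CommRing R] (h1 : ∀ e, E.weight e = 1) {g : G}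
    {I : TwoSidedIdeal (E.LeavittPathAlgebra R)} {c : E.LeavittPathAlgebra R}
    (hc : c ∈ homogeneousComponent R deg g) (hI : c ∈ I) (h0 : c ≠ 0) :
    ∃ a n, ∃ d ∈ Submodule.span R ((family E R).monomials (firstDegree deg) g a n),
      d ∈ I ∧ d ≠ 0 := by
  -- Multiplication by a vertex on the right selects the monomials whose ghost part starts there.
  -- One bound `n` serves all vertices, since only finitely many words occur.
  have key : ∀ c ∈ homogeneousComponent R deg g, ∃ n, ∀ a, c * (family E R).p a ∈
      Submodule.span R ((family E R).monomials (firstDegree deg) g a n) := by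
    intro c hc
    induction hc using Submodule.span_induction with
    | mem c hc =>
      obtain ⟨m, rfl, rfl⟩ := hc
      rcases word_mem_monomials R deg h1 m with h | ⟨b, n, h⟩
      · refine ⟨0, fun a => ?_⟩
        change word E R m * _ ∈ _
        rw [h, zero_mul]; exact zero_mem _
      · refine ⟨n, fun a => ?_⟩
        change word E R m * _ ∈ _
        by_cases hab : b = a
        · subst hab
          rw [LeavittFamily.monomials_mul_p h]
          exact Submodule.subset_span h
        · rw [← LeavittFamily.monomials_mul_p h, mul_assoc, (family E R).p_mul_ne _ _ hab, mul_zero]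
          exact zero_mem _
    | zero => exact ⟨0, fun a => by rw [zero_mul]; exact zero_mem _⟩
    | add c d _ _ hc hd =>
      obtain ⟨n, hn⟩ := hc
      obtain ⟨n', hn'⟩ := hd
      refine ⟨max n n', fun a => ?_⟩
      rw [add_mul]
      exact add_mem
        (Submodule.span_mono (LeavittFamily.monomials_mono (le_max_left n n')) (hn a))
        (Submodule.span_mono (LeavittFamily.monomials_mono (le_max_right n n')) (hn' a))
    | smul r c _ hc =>
      obtain ⟨n, hn⟩ := hc
      refine ⟨n, fun a => ?_⟩
      rw [smul_mul_assoc]; exact Submodule.smul_mem _ _ (hn a)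
  have hne : ∃ a, c * (family E R).p a ≠ 0 := by
    by_contra! h
    obtain ⟨T, hT⟩ := exists_finset_sum_mul_p R c
    exact h0 (by rw [← hT T subset_rfl, Finset.sum_eq_zero fun a _ => h a])
  obtain ⟨a, ha⟩ := hne
  obtain ⟨n, hn⟩ := key c hc
  exact ⟨a, n, _, hn a, I.mul_mem_right _ _ hI, ha⟩

/-- An ideal with a nonzero homogeneous element contains a nonzero homogeneous combination of
paths that end at the same vertex. -/
theorem exists_mem_span_paths [CommRing R] (h1 : ∀ e, E.weight e = 1) (hE : E.RowFinite)
    {I : TwoSidedIdeal (E.LeavittPathAlgebra R)} (n : ℕ) {g : G} {a : V}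
    {c : E.LeavittPathAlgebra R}
    (hc : c ∈ Submodule.span R ((family E R).monomials (firstDegree deg) g a n))
    (hI : c ∈ I) (h0 : c ≠ 0) :
    ∃ g b, ∃ d ∈ Submodule.span R ((family E R).monomials (firstDegree deg) g b 0),
      d ∈ I ∧ d ≠ 0 := by
  induction n generalizing g a c with
  | zero => exact ⟨g, a, c, hc, hI, h0⟩
  | succ n ih =>
    have hca : c * (family E R).p a = c := by
      clear hI h0
      induction hc using Submodule.span_induction with
      | mem c hc => exact LeavittFamily.monomials_mul_p hc
      | zero => rw [zero_mul]
      | add c d _ _ hc hd => rw [add_mul, hc, hd]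
      | smul r c _ hc => rw [smul_mul_assoc, hc]
    -- If `a` emits edges, `a = ∑ e e^*` yields an edge with `c e ≠ 0`, and `c e` has shorter ghost
    -- parts. If `a` is a sink, all ghost parts are already trivial.
    by_cases hs : ∃ e, E.source e = a
    · have hne : ∃ e, E.source e = a ∧ c * (family E R).x e 0 ≠ 0 := by
        by_contra! h
        refine h0 ?_
        rw [← hca, ← (family E R).sum_x_mul_y_self hE hs, Finset.mul_sum]
        refine Finset.sum_eq_zero fun e he => ?_
        rw [← mul_assoc, h e (by simpa using he), zero_mul]
      obtain ⟨e, rfl, he⟩ := hne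
      refine ih (g := g + firstDegree deg e) (a := E.range e) ?_ (I.mul_mem_right _ _ hI) he
      exact span_map_of_maps (LinearMap.mulRight R ((family E R).x e 0))
        (fun d hd => LeavittFamily.monomials_mul_x h1 hd) hc
    · refine ⟨g, a, c, Submodule.span_mono ?_ hc, hI, h0⟩
      rintro _ ⟨b', l, m, b, hl, hm, -, hg, rfl⟩
      cases m with
      | nil => exact ⟨b', l, [], b, hl, hm, le_rfl, hg, rfl⟩
      | cons f m => exact absurd ⟨f, hm.1⟩ hs

/-- If closed paths of degree `0` are trivial, then a nonzero graded ideal of the Leavitt path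
algebra of a row-finite graph contains a nonzero vertex. -/
theorem IsGradedIdeal.exists_p_mem {K : Type w} [Field K] (h1 : ∀ e, E.weight e = 1)
    (hE : E.RowFinite)
    (hd : ∀ a l, E.IsPath a l a → (l.map (firstDegree deg)).sum = 0 → l = [])
    {I : TwoSidedIdeal (E.LeavittPathAlgebra K)} (hI : IsGradedIdeal K deg I) (h : I ≠ ⊥) :
    ∃ v, (family E K).p v ∈ I ∧ (family E K).p v ≠ 0 := by
  obtain ⟨g, c, hc, hcI, h0⟩ := hI.exists_homogeneous_ne_zero K deg h
  obtain ⟨a, n, c, hc, hcI, h0⟩ := exists_mem_span_monomials h1 hc hcI h0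
  obtain ⟨g, b, c, hc, hcI, h0⟩ := exists_mem_span_paths h1 hE n hc hcI h0
  have hsub : (family E K).monomials (firstDegree deg) g b 0 ⊆
      (fun l => (family E K).path l b) ''
        {l | (∃ a, E.IsPath a l b) ∧ (l.map (firstDegree deg)).sum = g} := by
    rintro _ ⟨a, l, m, b', hl, hm, hn, rfl, rfl⟩
    obtain rfl := List.length_eq_zero_iff.1 (Nat.le_zero.1 hn)
    obtain rfl := hm
    refine ⟨l, ⟨⟨a, hl⟩, by simp⟩, ?_⟩
    rw [LeavittFamily.ghostPath, LeavittFamily.path_mul_p]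
  obtain ⟨t, ht, rfl⟩ := (Finsupp.mem_span_image_iff_linearCombination K).1
    (Submodule.span_mono hsub hc)
  rw [Finsupp.linearCombination_apply, Finsupp.sum] at h0 hcI
  obtain ⟨l, hl, hl0⟩ := Finset.exists_ne_zero_of_sum_ne_zero h0
  have ht' := (Finsupp.mem_supported _ _).1 ht
  obtain ⟨⟨a, hla⟩, hlg⟩ := ht' hl
  -- The paths in the combination have equal degree and end at `b`, so the ghost of one of them
  -- annihilates all the others and isolates its coefficient.
  have hmul : (family E K).ghostPath l b * ∑ m ∈ t.support, t m • (family E K).path m b =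
      t l • (family E K).p b := by
    rw [Finset.mul_sum, Finset.sum_eq_single l]
    · rw [mul_smul_comm, (family E K).ghostPath_mul_path_self h1 hla]
    · intro m hm hne
      obtain ⟨⟨a', hma⟩, hmg⟩ := ht' hm
      rw [mul_smul_comm, (family E K).ghostPath_mul_path_ne _ h1 hd hla hma (hlg.trans hmg.symm)
        hne.symm, smul_zero]
    · exact fun h => absurd hl h
  have htl : t l ≠ 0 := Finsupp.mem_support_iff.1 hl
  have hmem := I.mul_mem_left ((t l)⁻¹ • (family E K).p b) _
    (I.mul_mem_left ((family E K).ghostPath l b) _ hcI)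
  rw [hmul, smul_mul_smul_comm, inv_mul_cancel₀ htl, one_smul, (family E K).p_mul_self] at hmem
  refine ⟨b, hmem, fun hb => hl0 ?_⟩
  rw [← (family E K).path_mul_p, hb, mul_zero, smul_zero]

/-- Graded simplicity of the Leavitt path algebra of a row-finite graph does not depend on the
grading if closed paths of degree `0` are trivial. -/
theorem IsGradedSimple.change_degree {K : Type w} [Field K] {G' : Type*} [AddCommGroup G']
    {deg' : E.Edge → G'} (h1 : ∀ e, E.weight e = 1) (hE : E.RowFinite)
    (hd : ∀ a l, E.IsPath a l a → (l.map (firstDegree deg')).sum = 0 → l = [])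
    (hs : IsGradedSimple K deg) : IsGradedSimple K deg' := by
  refine ⟨hs.1, fun I hI => ?_⟩
  by_cases h : I = ⊥
  · exact Or.inl h
  obtain ⟨v, hv, h0⟩ := hI.exists_p_mem h1 hE hd h
  refine Or.inr ?_
  have hle : TwoSidedIdeal.span {(family E K).p v} ≤ I := by
    rw [TwoSidedIdeal.span_le, Set.singleton_subset_iff]; exact hv
  -- A vertex has degree 0 for every degree map, so its ideal is graded for `deg` too.
  rcases hs.2 _ (isGradedIdeal_span_singleton K deg (family_p_mem K deg v)) with h' | h'
  · refine absurd ?_ h0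
    rw [← TwoSidedIdeal.mem_bot, ← h']
    exact TwoSidedIdeal.subset_span rfl
  · rw [h', top_le_iff] at hle; exact hle

end Reduction
end WeightedGraph

namespace WeightedGraph

/-! ### Reducible graphs: the relations of `E` and of `F` correspond -/

section Reducible

open LeavittPathAlgebra

variable {V : Type u} {S : Type v} {E : WeightedGraph V S}

theorem weight_eq_one_of_source_notMem {α : S} (h : E.source α ∉ E.weightForest) :
    E.weight α = 1 := by
  have := E.weight_pos α
  by_contra hne
  exact h ⟨E.source α, ⟨α, rfl, by omega⟩, .refl⟩

theorem range_mem_weightForest {α : S} (h : E.source α ∈ E.weightForest) :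
    E.range α ∈ E.weightForest := by
  obtain ⟨a, ha, hr⟩ := h
  exact ⟨a, ha, hr.tail ⟨α, rfl, rfl⟩⟩

theorem IsReducible.eq_of_source (h : E.IsReducible) {α β : S} (hα : E.source α ∈ E.weightForest)
    (hs : E.source α = E.source β) : α = β :=
  (h _ hα).1 rfl hs.symm

theorem IsReducible.eq_of_range (h : E.IsReducible) {α β : S} (hα : E.source α ∈ E.weightForest)
    (hβ : E.source β ∈ E.weightForest) (hr : E.range α = E.range β) : α = β :=
  (h _ (range_mem_weightForest hα)).2 ⟨rfl, hα⟩ ⟨hr.symm, hβ⟩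

theorem unweighted_source_of_mem {e : E.Edge} (h : E.source e.1 ∈ E.weightForest) :
    E.unweighted.source e = E.range e.1 := if_pos h

theorem unweighted_source_of_notMem {e : E.Edge} (h : E.source e.1 ∉ E.weightForest) :
    E.unweighted.source e = E.source e.1 := if_neg h

theorem unweighted_range_of_mem {e : E.Edge} (h : E.source e.1 ∈ E.weightForest) :
    E.unweighted.range e = E.source e.1 := if_pos h

theorem unweighted_range_of_notMem {e : E.Edge} (h : E.source e.1 ∉ E.weightForest) :
    E.unweighted.range e = E.range e.1 := if_neg h

/-- The weight forest is closed under ranges. Consequently the edges of `F` emitted by one vertex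
are either all reversed or all kept, and the sums in relation (3) never mix the two kinds. -/
theorem unweighted_source_mem_iff {e : E.Edge} :
    E.unweighted.source e ∈ E.weightForest ↔ E.source e.1 ∈ E.weightForest := by
  by_cases h : E.source e.1 ∈ E.weightForest
  · rw [unweighted_source_of_mem h]
    exact iff_of_true (range_mem_weightForest h) h
  · rw [unweighted_source_of_notMem h]

theorem unweighted_weight (e : E.Edge) : E.unweighted.weight e = 1 := rfl

/-- Kept edges at `v` come from the finitely many structured edges that `v` emits, reversed ones
from the at most one structured edge that arrives from the weight forest; each gives finitely many
`α_i`. -/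
theorem unweighted_rowFinite (hE : E.RowFinite) (hred : E.IsReducible) :
    E.unweighted.RowFinite := by
  intro v
  have h1 : {α | E.range α = v ∧ E.source α ∈ E.weightForest}.Finite := by
    by_cases hv : v ∈ E.weightForest
    · exact (hred v hv).2.finite
    · refine Set.finite_empty.subset ?_
      rintro α ⟨rfl, h⟩
      exact hv (range_mem_weightForest h)
  refine Set.Finite.subset (Set.Finite.preimage' ((hE v).union h1) (f := Sigma.fst)
    fun α _ => ?_) ?_
  · refine (Set.finite_range (Sigma.mk α)).subset ?_
    rintro ⟨β, i⟩ h
    obtain rfl : β = α := h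
    exact ⟨i, rfl⟩
  · rintro e rfl
    by_cases h : E.source e.1 ∈ E.weightForest
    · exact Or.inr ⟨(unweighted_source_of_mem h).symm, h⟩
    · exact Or.inl (unweighted_source_of_notMem h).symm

variable {A : Type*} [NonUnitalRing A]

open Classical in
/-- A Leavitt family for a reducible weighted graph yields one for the associated unweighted
graph. -/
noncomputable def LeavittFamily.toUnweighted (hred : E.IsReducible) (F : LeavittFamily E A) :
    LeavittFamily E.unweighted A where
  p := F.p
  -- The graph `F` has only the index `0`; the index of `α_i` is recorded in the edge itself, as
  -- `e.2`.
  x e i := if i = 0 then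
    if E.source e.1 ∈ E.weightForest then F.y e.1 e.2 else F.x e.1 e.2 else 0
  y e i := if i = 0 then
    if E.source e.1 ∈ E.weightForest then F.x e.1 e.2 else F.y e.1 e.2 else 0
  x_eq_zero e i h := if_neg (by rw [unweighted_weight] at h; omega)
  y_eq_zero e i h := if_neg (by rw [unweighted_weight] at h; omega)
  p_mul_self := F.p_mul_self
  p_mul_ne := F.p_mul_ne
  p_mul_x e i := by
    split_ifs with hi h
    · rw [unweighted_source_of_mem h, F.p_mul_y]
    · rw [unweighted_source_of_notMem h, F.p_mul_x]
    · exact mul_zero _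
  x_mul_p e i := by
    split_ifs with hi h
    · rw [unweighted_range_of_mem h, F.y_mul_p]
    · rw [unweighted_range_of_notMem h, F.x_mul_p]
    · exact zero_mul _
  p_mul_y e i := by
    split_ifs with hi h
    · rw [unweighted_range_of_mem h, F.p_mul_x]
    · rw [unweighted_range_of_notMem h, F.p_mul_y]
    · exact mul_zero _
  y_mul_p e i := by
    split_ifs with hi h
    · rw [unweighted_source_of_mem h, F.x_mul_p]
    · rw [unweighted_source_of_notMem h, F.y_mul_p]
    · exact zero_mul _
  sum_x_mul_y v hv i j hi hj := by
    obtain ⟨e, rfl, hi⟩ := hi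
    obtain ⟨e', -, hj⟩ := hj
    obtain rfl : i = 0 := by rw [unweighted_weight] at hi; omega
    obtain rfl : j = 0 := by rw [unweighted_weight] at hj; omega
    simp only [if_true]
    by_cases h : E.source e.1 ∈ E.weightForest
    -- On the weight forest, relation (3) of `F` at `r(α)` is relation (4) of `E` for `α`, the only
    -- structured edge that arrives there from the forest.
    · rw [congrArg F.p (unweighted_source_of_mem h), ← F.sum_y_mul_x_self]
      symm
      refine Finset.sum_bij (fun i hi => ⟨e.1, i, Finset.mem_range.1 hi⟩) ?_ ?_ ?_ ?_
      · intro i hi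
        simp only [Set.Finite.mem_toFinset, Set.mem_ofPred_eq]
        rw [unweighted_source_of_mem h]
        exact unweighted_source_of_mem h
      · intro i _ j _ hij
        simpa using hij
      · rintro f hf
        simp only [Set.Finite.mem_toFinset, Set.mem_ofPred_eq] at hf
        have hfW : E.source f.1 ∈ E.weightForest := by
          rwa [← unweighted_source_mem_iff, hf, unweighted_source_mem_iff]
        rw [unweighted_source_of_mem h, unweighted_source_of_mem hfW] at hf
        obtain ⟨β, i⟩ := f
        obtain rfl : β = e.1 := hred.eq_of_range hfW h hf
        exact ⟨i, Finset.mem_range.2 i.2, rfl⟩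
      · intro i _
        simp only [if_pos h]
    · rw [congrArg F.p (unweighted_source_of_notMem h)]
      -- Outside the weight forest weights are 1, so structured edges correspond to edges of `F` and
      -- finiteness is inherited from `hv`.
      have hfin : {α | E.source α = E.source e.1}.Finite := by
        refine (hv.image Sigma.fst).subset fun α hα => ⟨⟨α, 0, E.weight_pos α⟩, ?_, rfl⟩
        change E.source α = E.source e.1 at hα
        change E.unweighted.source _ = _
        rw [unweighted_source_of_notMem h, unweighted_source_of_notMem (by rwa [hα]), hα]
      have := F.sum_x_mul_y _ hfin 0 0 ⟨e.1, rfl, E.weight_pos _⟩ ⟨e.1, rfl, E.weight_pos _⟩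
      rw [if_pos rfl] at this
      rw [← this]
      symm
      refine Finset.sum_bij (fun α _ => ⟨α, 0, E.weight_pos α⟩) ?_ ?_ ?_ ?_
      · intro α hα
        simp only [Set.Finite.mem_toFinset, Set.mem_ofPred_eq] at hα ⊢
        rw [unweighted_source_of_notMem h, unweighted_source_of_notMem (by rwa [hα]), hα]
      · intro α _ β _ hαβ
        exact congrArg Sigma.fst hαβ
      · intro f hf
        simp only [Set.Finite.mem_toFinset, Set.mem_ofPred_eq] at hf
        have hfW : E.source f.1 ∉ E.weightForest := by
          rwa [← unweighted_source_mem_iff, hf, unweighted_source_mem_iff]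
        rw [unweighted_source_of_notMem h, unweighted_source_of_notMem hfW] at hf
        obtain ⟨β, i, hi⟩ := f
        have := weight_eq_one_of_source_notMem hfW
        obtain rfl : i = 0 := by simp only at this; omega
        exact ⟨β, by simpa using hf, rfl⟩
      · intro α hα
        simp only [Set.Finite.mem_toFinset, Set.mem_ofPred_eq] at hα
        simp only [hα, if_neg h]
  sum_y_mul_x_self e := by
    rw [unweighted_weight, Finset.sum_range_one]
    simp only [if_true]
    split_ifs with h
    -- Relation (4) for a reversed edge is the diagonal case of relation (3) of `E`, whose sum has
    -- one term.
    · have hs : {α | E.source α = E.source e.1} = {e.1} :=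
        Set.eq_singleton_iff_unique_mem.2 ⟨rfl, fun β hβ => (hred.eq_of_source h (Eq.symm hβ)).symm⟩
      have hfin : {α | E.source α = E.source e.1}.Finite := hs ▸ Set.finite_singleton _
      have := F.sum_x_mul_y _ hfin e.2 e.2 ⟨e.1, rfl, e.2.2⟩ ⟨e.1, rfl, e.2.2⟩
      rw [if_pos rfl] at this
      rw [unweighted_range_of_mem h, ← this]
      simp [hs]
    · have h1 := weight_eq_one_of_source_notMem h
      have h0 : (e.2 : ℕ) = 0 := by have := e.2.2; omega
      rw [unweighted_range_of_notMem h, h0, F.y_mul_x_self h1]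
  sum_y_mul_x_ne e f hne := by
    rw [unweighted_weight, unweighted_weight, max_self, Finset.sum_range_one]
    simp only [if_true]
    split_ifs with h h' h'
    -- Two reversed edges that start at the same vertex of `F` belong to one structured edge and
    -- differ in the index: this is the off-diagonal case of relation (3).
    · by_cases hr : E.range e.1 = E.range f.1
      · obtain ⟨α, i⟩ := e
        obtain ⟨β, j⟩ := f
        obtain rfl : α = β := hred.eq_of_range h h' hr
        have hij : (i : ℕ) ≠ j := fun hij => hne (by rw [Fin.ext hij])
        have hs : {β | E.source β = E.source α} = {α} :=
          Set.eq_singleton_iff_unique_mem.2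
            ⟨rfl, fun β hβ => (hred.eq_of_source h (Eq.symm hβ)).symm⟩
        have hfin : {β | E.source β = E.source α}.Finite := hs ▸ Set.finite_singleton _
        have := F.sum_x_mul_y _ hfin i j ⟨α, rfl, i.2⟩ ⟨α, rfl, j.2⟩
        rw [if_neg hij] at this
        rw [← this]
        simp [hs]
      · rw [← F.x_mul_p, mul_assoc, F.p_mul_y_ne _ hr, mul_zero]
    -- A reversed and a kept edge do not meet: the vertex between them would be both inside and
    -- outside the weight forest.
    · have hr : E.range e.1 ≠ E.source f.1 := by
        rintro hr
        exact h' (hr ▸ range_mem_weightForest h)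
      rw [← F.x_mul_p, mul_assoc, F.p_mul_x_ne _ hr, mul_zero]
    · have hr : E.source e.1 ≠ E.range f.1 := by
        rintro hr
        exact h (hr ▸ range_mem_weightForest h')
      rw [← F.y_mul_p, mul_assoc, F.p_mul_y_ne _ hr, mul_zero]
    · have h1 := weight_eq_one_of_source_notMem h
      have h1' := weight_eq_one_of_source_notMem h'
      obtain ⟨α, i, hi⟩ := e
      obtain ⟨β, j, hj⟩ := f
      simp only at h1 h1' ⊢
      obtain rfl : i = 0 := by omega
      obtain rfl : j = 0 := by omega
      exact F.y_mul_x_ne h1 h1' fun h => hne (by subst h; rfl)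

open Classical in
/-- A Leavitt family for the unweighted graph associated with a reducible weighted graph yields one
for the weighted graph. -/
noncomputable def LeavittFamily.ofUnweighted (hE : E.RowFinite) (hred : E.IsReducible)
    (F : LeavittFamily E.unweighted A) : LeavittFamily E A where
  p := F.p
  x α i := if h : i < E.weight α then
    if E.source α ∈ E.weightForest then F.y ⟨α, i, h⟩ 0 else F.x ⟨α, i, h⟩ 0 else 0
  y α i := if h : i < E.weight α then
    if E.source α ∈ E.weightForest then F.x ⟨α, i, h⟩ 0 else F.y ⟨α, i, h⟩ 0 else 0
  x_eq_zero α i h := dif_neg h.not_gt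
  y_eq_zero α i h := dif_neg h.not_gt
  p_mul_self := F.p_mul_self
  p_mul_ne := F.p_mul_ne
  p_mul_x α i := by
    split_ifs with hi h
    · have := F.p_mul_y ⟨α, i, hi⟩ 0
      rwa [unweighted_range_of_mem h] at this
    · have := F.p_mul_x ⟨α, i, hi⟩ 0
      rwa [unweighted_source_of_notMem h] at this
    · exact mul_zero _
  x_mul_p α i := by
    split_ifs with hi h
    · have := F.y_mul_p ⟨α, i, hi⟩ 0
      rwa [unweighted_source_of_mem h] at this
    · have := F.x_mul_p ⟨α, i, hi⟩ 0
      rwa [unweighted_range_of_notMem h] at this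
    · exact zero_mul _
  p_mul_y α i := by
    split_ifs with hi h
    · have := F.p_mul_x ⟨α, i, hi⟩ 0
      rwa [unweighted_source_of_mem h] at this
    · have := F.p_mul_y ⟨α, i, hi⟩ 0
      rwa [unweighted_range_of_notMem h] at this
    · exact mul_zero _
  y_mul_p α i := by
    split_ifs with hi h
    · have := F.x_mul_p ⟨α, i, hi⟩ 0
      rwa [unweighted_range_of_mem h] at this
    · have := F.y_mul_p ⟨α, i, hi⟩ 0
      rwa [unweighted_source_of_notMem h] at this
    · exact zero_mul _
  sum_x_mul_y v hv i j hi hj := by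
    obtain ⟨α, rfl, hi⟩ := hi
    obtain ⟨β, hβ, hj⟩ := hj
    by_cases h : E.source α ∈ E.weightForest
    · obtain rfl := hred.eq_of_source h hβ.symm
      have hs : hv.toFinset = {α} := by
        ext β
        simp only [Set.Finite.mem_toFinset, Set.mem_ofPred_eq, Finset.mem_singleton]
        exact ⟨fun hβ => (hred.eq_of_source h hβ.symm).symm, fun hβ => by rw [hβ]⟩
      rw [hs, Finset.sum_singleton, dif_pos hi, dif_pos hj, if_pos h, if_pos h]
      split_ifs with hij
      · subst hij
        rw [F.y_mul_x_self (unweighted_weight _), unweighted_range_of_mem h]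
      · refine F.y_mul_x_ne (unweighted_weight _) (unweighted_weight _) fun he => hij ?_
        simpa using he
    · have h1 := weight_eq_one_of_source_notMem h
      have h1' := weight_eq_one_of_source_notMem (hβ ▸ h)
      obtain rfl : i = 0 := by omega
      obtain rfl : j = 0 := by omega
      rw [if_pos rfl, ← F.sum_x_mul_y_self (unweighted_rowFinite hE hred) (v := E.source α)
        ⟨⟨α, 0, hi⟩, unweighted_source_of_notMem h⟩]
      refine Finset.sum_bij (fun α _ => ⟨α, 0, E.weight_pos α⟩) ?_ ?_ ?_ ?_
      · intro γ hγ
        simp only [Set.Finite.mem_toFinset, Set.mem_ofPred_eq] at hγ ⊢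
        rw [unweighted_source_of_notMem (by rwa [hγ]), hγ]
      · intro α _ β _ hαβ
        exact congrArg Sigma.fst hαβ
      · intro f hf
        simp only [Set.Finite.mem_toFinset, Set.mem_ofPred_eq] at hf
        have hfW : E.source f.1 ∉ E.weightForest := by
          rwa [← unweighted_source_mem_iff, hf]
        rw [unweighted_source_of_notMem hfW] at hf
        obtain ⟨β, i, hi⟩ := f
        have := weight_eq_one_of_source_notMem hfW
        obtain rfl : i = 0 := by simp only at this; omega
        exact ⟨β, by simpa using hf, rfl⟩
      · intro γ hγ
        simp only [Set.Finite.mem_toFinset, Set.mem_ofPred_eq] at hγ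
        simp only [hγ, if_neg h, dif_pos (E.weight_pos γ)]
  sum_y_mul_x_self α := by
    by_cases h : E.source α ∈ E.weightForest
    · rw [← F.sum_x_mul_y_self (unweighted_rowFinite hE hred) (v := E.range α)
        ⟨⟨α, 0, E.weight_pos α⟩, unweighted_source_of_mem h⟩]
      refine Finset.sum_bij (fun i hi => ⟨α, i, Finset.mem_range.1 hi⟩) ?_ ?_ ?_ ?_
      · intro i hi
        simp only [Set.Finite.mem_toFinset, Set.mem_ofPred_eq]
        rw [unweighted_source_of_mem h]
      · intro i _ j _ hij
        simpa using hij
      · rintro f hf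
        simp only [Set.Finite.mem_toFinset, Set.mem_ofPred_eq] at hf
        have hfW : E.source f.1 ∈ E.weightForest := by
          rw [← unweighted_source_mem_iff, hf]
          exact range_mem_weightForest h
        rw [unweighted_source_of_mem hfW] at hf
        obtain ⟨β, i⟩ := f
        obtain rfl : β = α := hred.eq_of_range hfW h hf
        exact ⟨i, Finset.mem_range.2 i.2, rfl⟩
      · intro i hi
        simp only [if_pos h, dif_pos (Finset.mem_range.1 hi)]
    · rw [congrArg Finset.range (weight_eq_one_of_source_notMem h), Finset.sum_range_one]
      simp only [dif_pos (E.weight_pos α), if_neg h]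
      have := F.y_mul_x_self (unweighted_weight ⟨α, 0, E.weight_pos α⟩)
      rwa [unweighted_range_of_notMem h] at this
  sum_y_mul_x_ne α β hne := by
    -- Every term vanishes by itself. On the weight forest distinct structured edges have distinct
    -- sources, and outside it distinct edges of `F` are orthogonal.
    refine Finset.sum_eq_zero fun i _ => ?_
    split_ifs with hi h hj h' hj h' hj h'
    · by_cases hs : E.source α = E.source β
      · exact absurd (hred.eq_of_source h hs) hne
      · rw [← F.x_mul_p, mul_assoc, unweighted_range_of_mem h, F.p_mul_y_ne, mul_zero]
        rwa [unweighted_range_of_mem h']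
    · have hs : E.source α ≠ E.source β := fun hs => h' (hs ▸ h)
      rw [← F.x_mul_p, mul_assoc, unweighted_range_of_mem h, F.p_mul_x_ne, mul_zero]
      rwa [unweighted_source_of_notMem h']
    · exact mul_zero _
    · have hs : E.source α ≠ E.source β := fun hs => h (hs ▸ h')
      rw [← F.y_mul_p, mul_assoc, unweighted_source_of_notMem h, F.p_mul_y_ne, mul_zero]
      rwa [unweighted_range_of_mem h']
    · exact F.y_mul_x_ne (unweighted_weight _) (unweighted_weight _)
        fun he => hne (congrArg Sigma.fst he)
    · exact mul_zero _
    all_goals exact zero_mul _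

/-! ### Closed paths of `F` and the transported multidegree -/

open Classical in
/-- The degree map on the associated unweighted graph that corresponds to the standard degree map of
the weighted graph. -/
noncomputable def unweightedMultidegree (E : WeightedGraph V S) (e : E.unweighted.Edge) :
    E.WeightIndex →₀ ℤ :=
  if E.source e.1.1 ∈ E.weightForest then -E.multidegree e.1 else E.multidegree e.1

theorem degree_firstDegree_of_mem {e : E.Edge} (h : E.source e.1 ∈ E.weightForest) :
    Finsupp.degree (firstDegree E.unweightedMultidegree e) = -1 := by
  rw [firstDegree, unweightedMultidegree, if_pos h, multidegree, map_neg, Finsupp.degree_single]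

theorem degree_firstDegree_of_notMem {e : E.Edge} (h : E.source e.1 ∉ E.weightForest) :
    Finsupp.degree (firstDegree E.unweightedMultidegree e) = 1 := by
  rw [firstDegree, unweightedMultidegree, if_neg h, multidegree, Finsupp.degree_single]

/-- No edge of `F` leaves the weight forest, so such a path uses reversed edges only, each of total
degree `-1`. `Finsupp.degree` collapses the multidegree to an integer. -/
theorem degree_path_of_mem {a b : V} {l : List E.Edge} (h : E.unweighted.IsPath a l b)
    (ha : a ∈ E.weightForest) : b ∈ E.weightForest ∧
      Finsupp.degree (l.map (firstDegree E.unweightedMultidegree)).sum = -l.length := by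
  induction l generalizing a with
  | nil => obtain rfl := h; simpa using ha
  | cons e l ih =>
    obtain ⟨rfl, h⟩ := h
    rw [unweighted_source_mem_iff] at ha
    obtain ⟨hb, hl⟩ := ih h (by rwa [unweighted_range_of_mem ha])
    refine ⟨hb, ?_⟩
    rw [List.map_cons, List.sum_cons, map_add, hl, degree_firstDegree_of_mem ha, List.length_cons]
    push_cast
    ring

/-- A path that ends outside the weight forest was never in it, so all its edges are kept and have
total degree `1`. -/
theorem degree_path_of_notMem {a b : V} {l : List E.Edge} (h : E.unweighted.IsPath a l b)
    (hb : b ∉ E.weightForest) :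
    Finsupp.degree (l.map (firstDegree E.unweightedMultidegree)).sum = l.length := by
  induction l generalizing a with
  | nil => simp
  | cons e l ih =>
    obtain ⟨rfl, h⟩ := h
    have he : E.source e.1 ∉ E.weightForest := fun he =>
      hb (degree_path_of_mem h (by rwa [unweighted_range_of_mem he])).1
    rw [List.map_cons, List.sum_cons, map_add, ih h, degree_firstDegree_of_notMem he,
      List.length_cons]
    push_cast
    ring

/-- Nontrivial closed paths in the associated unweighted graph have nonzero multidegree. -/
theorem eq_nil_of_closed_of_multidegree_eq_zero (a : V) (l : List E.Edge)
    (h : E.unweighted.IsPath a l a)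
    (h0 : (l.map (firstDegree E.unweightedMultidegree)).sum = 0) : l = [] := by
  rw [← List.length_eq_zero_iff]
  by_cases ha : a ∈ E.weightForest
  · have := (degree_path_of_mem h ha).2
    rw [h0, map_zero] at this
    omega
  · have := degree_path_of_notMem h ha
    rw [h0, map_zero] at this
    omega

theorem eq_nil_of_unitDegree_eq_zero (F : WeightedGraph V S) (a : V) (l : List S)
    (_ : F.IsPath a l a) (h0 : (l.map (firstDegree F.unitDegree)).sum = 0) : l = [] := by
  have key : ∀ l : List S, (l.map (firstDegree F.unitDegree)).sum = l.length := by
    intro l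
    induction l with
    | nil => rfl
    | cons e l ih =>
      rw [List.map_cons, List.sum_cons, ih, List.length_cons, firstDegree, unitDegree]
      push_cast
      ring
  rw [← List.length_eq_zero_iff]
  rw [key] at h0
  omega

/-! ### The isomorphism between the two algebras -/

section Isomorphism

variable (R : Type w) [CommRing R] (hE : E.RowFinite) (hred : E.IsReducible)

/-- The homomorphism from the algebra of a reducible weighted graph to the algebra of the associated
unweighted graph. -/
noncomputable def toUnweightedHom :
    E.LeavittPathAlgebra R →ₙₐ[R] E.unweighted.LeavittPathAlgebra R :=
  lift R ((family E.unweighted R).ofUnweighted hE hred)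

/-- The homomorphism from the algebra of the unweighted graph associated with a reducible weighted
graph to the algebra of the weighted graph. -/
noncomputable def ofUnweightedHom :
    E.unweighted.LeavittPathAlgebra R →ₙₐ[R] E.LeavittPathAlgebra R :=
  lift R ((family E R).toUnweighted hred)

open Classical in
theorem toUnweightedHom_x (e : E.Edge) : toUnweightedHom R hE hred ((family E R).x e.1 e.2) =
    if E.source e.1 ∈ E.weightForest then (family E.unweighted R).y e 0
    else (family E.unweighted R).x e 0 :=
  (lift_x R _ _ _).trans (dif_pos e.2.2)

open Classical in
theorem toUnweightedHom_y (e : E.Edge) : toUnweightedHom R hE hred ((family E R).y e.1 e.2) =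
    if E.source e.1 ∈ E.weightForest then (family E.unweighted R).x e 0
    else (family E.unweighted R).y e 0 :=
  (lift_y R _ _ _).trans (dif_pos e.2.2)

open Classical in
theorem ofUnweightedHom_x (e : E.Edge) : ofUnweightedHom R hred ((family E.unweighted R).x e 0) =
    if E.source e.1 ∈ E.weightForest then (family E R).y e.1 e.2 else (family E R).x e.1 e.2 :=
  by rw [ofUnweightedHom, lift_x]; simp only [LeavittFamily.toUnweighted, if_true]

open Classical in
theorem ofUnweightedHom_y (e : E.Edge) : ofUnweightedHom R hred ((family E.unweighted R).y e 0) =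
    if E.source e.1 ∈ E.weightForest then (family E R).x e.1 e.2 else (family E R).y e.1 e.2 :=
  by rw [ofUnweightedHom, lift_y]; simp only [LeavittFamily.toUnweighted, if_true]

theorem unweighted_gen_edge (e : E.unweighted.Edge) :
    gen E.unweighted R (.edge e) = (family E.unweighted R).x e.1 0 := by
  have h : (e.2 : ℕ) < 1 := e.2.2
  rw [gen_edge, Nat.lt_one_iff.1 h]

theorem unweighted_gen_ghost (e : E.unweighted.Edge) :
    gen E.unweighted R (.ghost e) = (family E.unweighted R).y e.1 0 := by
  have h : (e.2 : ℕ) < 1 := e.2.2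
  rw [gen_ghost, Nat.lt_one_iff.1 h]

theorem ofUnweightedHom_toUnweightedHom (a : E.LeavittPathAlgebra R) :
    ofUnweightedHom R hred (toUnweightedHom R hE hred a) = a := by
  have : (ofUnweightedHom R hred).comp (toUnweightedHom R hE hred) = NonUnitalAlgHom.id R _ := by
    refine hom_ext ?_
    rintro (v | e | e)
    · exact (congrArg _ (lift_p R _ v)).trans (lift_p R _ v)
    · rw [NonUnitalAlgHom.comp_apply, gen_edge, toUnweightedHom_x]
      split_ifs with h
      · rw [ofUnweightedHom_y, if_pos h]; rfl
      · rw [ofUnweightedHom_x, if_neg h]; rfl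
    · rw [NonUnitalAlgHom.comp_apply, gen_ghost, toUnweightedHom_y]
      split_ifs with h
      · rw [ofUnweightedHom_x, if_pos h]; rfl
      · rw [ofUnweightedHom_y, if_neg h]; rfl
  exact congrArg (fun f => f a) this

theorem toUnweightedHom_ofUnweightedHom (a : E.unweighted.LeavittPathAlgebra R) :
    toUnweightedHom R hE hred (ofUnweightedHom R hred a) = a := by
  have : (toUnweightedHom R hE hred).comp (ofUnweightedHom R hred) = NonUnitalAlgHom.id R _ := by
    refine hom_ext ?_
    rintro (v | e | e)
    · exact (congrArg _ (lift_p R _ v)).trans (lift_p R _ v)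
    · rw [NonUnitalAlgHom.comp_apply, unweighted_gen_edge, ofUnweightedHom_x]
      split_ifs with h
      · rw [toUnweightedHom_y, if_pos h]; rfl
      · rw [toUnweightedHom_x, if_neg h]; rfl
    · rw [NonUnitalAlgHom.comp_apply, unweighted_gen_ghost, ofUnweightedHom_y]
      split_ifs with h
      · rw [toUnweightedHom_x, if_pos h]; rfl
      · rw [toUnweightedHom_y, if_neg h]; rfl
  exact congrArg (fun f => f a) this

theorem toUnweightedHom_gen_mem (z : E.Gen) : toUnweightedHom R hE hred (gen E R z) ∈
    homogeneousComponent R E.unweightedMultidegree (genDegree E.multidegree z) := by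
  rcases z with v | e | e
  · exact (lift_p R ((family E.unweighted R).ofUnweighted hE hred) v).symm ▸ family_p_mem R _ v
  · rw [gen_edge, toUnweightedHom_x, genDegree]
    split_ifs with h
    · have := family_y_mem R E.unweightedMultidegree ⟨e, 0, Nat.one_pos⟩
      rwa [unweightedMultidegree, if_pos h, neg_neg] at this
    · have := family_x_mem R E.unweightedMultidegree ⟨e, 0, Nat.one_pos⟩
      rwa [unweightedMultidegree, if_neg h] at this
  · rw [gen_ghost, toUnweightedHom_y, genDegree]
    split_ifs with h
    · have := family_x_mem R E.unweightedMultidegree ⟨e, 0, Nat.one_pos⟩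
      rwa [unweightedMultidegree, if_pos h] at this
    · have := family_y_mem R E.unweightedMultidegree ⟨e, 0, Nat.one_pos⟩
      rwa [unweightedMultidegree, if_neg h] at this

theorem ofUnweightedHom_gen_mem (z : E.unweighted.Gen) :
    ofUnweightedHom R hred (gen E.unweighted R z) ∈
      homogeneousComponent R E.multidegree (genDegree E.unweightedMultidegree z) := by
  rcases z with v | e | e
  · exact (lift_p R ((family E R).toUnweighted hred) v).symm ▸ family_p_mem R _ v
  · rw [unweighted_gen_edge, ofUnweightedHom_x, genDegree, unweightedMultidegree]
    split_ifs with h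
    · exact family_y_mem R _ e.1
    · exact family_x_mem R _ e.1
  · rw [unweighted_gen_ghost, ofUnweightedHom_y, genDegree, unweightedMultidegree]
    split_ifs with h
    · rw [neg_neg]; exact family_x_mem R _ e.1
    · exact family_y_mem R _ e.1

end Isomorphism

/-- The isomorphism transports the multidegree to `unweightedMultidegree` on `F`. For this and for
the unit degree, closed paths of degree 0 are trivial, so graded simplicity passes between them in
both directions. -/
theorem IsReducible.isGradedSimple_iff (hE : E.RowFinite) (hred : E.IsReducible) (K : Type w)
    [Field K] : IsGradedSimple K E.multidegree ↔ IsGradedSimple K E.unweighted.unitDegree := by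
  have hF := unweighted_rowFinite hE hred
  constructor
  · intro h
    refine IsGradedSimple.change_degree (deg := E.unweightedMultidegree) unweighted_weight hF
      (eq_nil_of_unitDegree_eq_zero _) ?_
    exact h.of_inverse _ _ (toUnweightedHom_ofUnweightedHom K hE hred)
      (ofUnweightedHom_toUnweightedHom K hE hred) (ofUnweightedHom_gen_mem K hred)
  · intro h
    have h' : IsGradedSimple K E.unweightedMultidegree :=
      h.change_degree unweighted_weight hF eq_nil_of_closed_of_multidegree_eq_zero
    exact h'.of_inverse _ _ (ofUnweightedHom_toUnweightedHom K hE hred)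
      (toUnweightedHom_ofUnweightedHom K hE hred) (toUnweightedHom_gen_mem K hE hred)

end Reducible
end WeightedGraph

namespace WeightedGraph

/-! ### Representations from branching systems -/

/-- A combinatorial datum that defines a representation of the weighted Leavitt path algebra on the
free module with basis `V × ℕ`: for every vertex `v` a bijection between the pairs `(i, n)`, where
`α_{i+1}` exists for some `α` emitted by `v`, and the pairs `(α, m)`, where `v` emits `α`. -/
structure BranchingSystem {V : Type u} {S : Type v} (E : WeightedGraph V S) where
  out : V → ℕ → ℕ → S × ℕ
  inv : S → ℕ → ℕ × ℕ
  source_out : ∀ v i n, (∃ α, E.source α = v ∧ i < E.weight α) → E.source (out v i n).1 = v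
  inv_out : ∀ v i n, (∃ α, E.source α = v ∧ i < E.weight α) →
    inv (out v i n).1 (out v i n).2 = (i, n)
  inv_lt : ∀ α m, (inv α m).1 < E.weight α
  out_inv : ∀ α m, out (E.source α) (inv α m).1 (inv α m).2 = (α, m)

namespace BranchingSystem

variable {V : Type u} {S : Type v} {E : WeightedGraph V S} (B : BranchingSystem E)

section Representation

variable (R : Type w) [CommRing R]

/-- The basis vectors. -/
noncomputable def basis (v : V) (n : ℕ) : V × ℕ →₀ R := Finsupp.single (v, n) 1

theorem end_ext {f g : Module.End R (V × ℕ →₀ R)}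
    (h : ∀ v n, f (basis R v n) = g (basis R v n)) : f = g :=
  Finsupp.lhom_ext' fun b => LinearMap.ext_ring (h b.1 b.2)

theorem basis_ne_zero [Nontrivial R] (v : V) (n : ℕ) : basis R v n ≠ 0 := by
  rw [basis, Ne, Finsupp.single_eq_zero]
  exact one_ne_zero

open Classical in
/-- The projection onto the summand at a vertex. -/
noncomputable def repP (v : V) : Module.End R (V × ℕ →₀ R) :=
  Finsupp.linearCombination R fun b => if b.1 = v then basis R b.1 b.2 else 0

open Classical in
/-- The action of an edge. -/
noncomputable def repX (α : S) (i : ℕ) : Module.End R (V × ℕ →₀ R) :=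
  Finsupp.linearCombination R fun b =>
    if b.1 = E.range α ∧ (B.inv α b.2).1 = i then basis R (E.source α) (B.inv α b.2).2 else 0

open Classical in
/-- The action of a ghost edge. -/
noncomputable def repY (α : S) (i : ℕ) : Module.End R (V × ℕ →₀ R) :=
  Finsupp.linearCombination R fun b =>
    if b.1 = E.source α ∧ i < E.weight α ∧ (B.out b.1 i b.2).1 = α then
      basis R (E.range α) (B.out b.1 i b.2).2 else 0

open Classical in
theorem repP_basis (v u : V) (n : ℕ) :
    repP R v (basis R u n) = if u = v then basis R u n else 0 := by
  rw [repP, basis, Finsupp.linearCombination_single, one_smul, basis]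

open Classical in
theorem repX_basis (α : S) (i : ℕ) (u : V) (n : ℕ) : B.repX R α i (basis R u n) =
    if u = E.range α ∧ (B.inv α n).1 = i then basis R (E.source α) (B.inv α n).2 else 0 := by
  rw [repX, basis, Finsupp.linearCombination_single, one_smul]

open Classical in
theorem repY_basis (α : S) (i : ℕ) (u : V) (n : ℕ) : B.repY R α i (basis R u n) =
    if u = E.source α ∧ i < E.weight α ∧ (B.out u i n).1 = α then
      basis R (E.range α) (B.out u i n).2 else 0 := by
  rw [repY, basis, Finsupp.linearCombination_single, one_smul]

theorem lt_weight_out {v : V} {i : ℕ} (n : ℕ) (h : ∃ α, E.source α = v ∧ i < E.weight α) :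
    i < E.weight (B.out v i n).1 := by
  have := B.inv_lt (B.out v i n).1 (B.out v i n).2
  rwa [B.inv_out v i n h] at this

-- `β_i` sends the vector `m` at `r(β)` along `inv`, provided the index found is `i`, and `α_i^*`
-- returns along `out`, which leads back to `β` only. Summed over `i`, this is relation (4).
open Classical in
theorem repY_mul_repX (α β : S) (i : ℕ) (m : ℕ) :
    B.repY R α i (B.repX R β i (basis R (E.range β) m)) =
      if (B.inv β m).1 = i ∧ α = β then basis R (E.range β) m else 0 := by
  rw [repX_basis]
  by_cases hi : (B.inv β m).1 = i
  · subst hi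
    rw [if_pos ⟨rfl, rfl⟩, repY_basis, B.out_inv]
    by_cases h : α = β
    · subst h
      rw [if_pos ⟨rfl, B.inv_lt _ _, rfl⟩, if_pos ⟨rfl, rfl⟩]
    · rw [if_neg fun h' => h h'.2.2.symm, if_neg fun h' => h h'.2]
  · rw [if_neg fun h => hi h.2, if_neg fun h => hi h.1, map_zero]

/-- The family of endomorphisms defined by a branching system. -/
noncomputable def family : LeavittFamily E (Module.End R (V × ℕ →₀ R)) where
  p := repP R
  x := B.repX R
  y := B.repY R
  x_eq_zero α i h := end_ext R fun u n => by
    rw [repX_basis, if_neg, LinearMap.zero_apply]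
    rintro ⟨-, rfl⟩
    exact h.not_gt (B.inv_lt α n)
  y_eq_zero α i h := end_ext R fun u n => by
    rw [repY_basis, if_neg fun h' => h.not_gt h'.2.1, LinearMap.zero_apply]
  p_mul_self v := end_ext R fun u n => by
    rw [Module.End.mul_apply, repP_basis]
    split_ifs with h
    · rw [repP_basis, if_pos h]
    · rw [map_zero]
  p_mul_ne v w h := end_ext R fun u n => by
    rw [Module.End.mul_apply, repP_basis, LinearMap.zero_apply]
    split_ifs with h'
    · rw [repP_basis, if_neg fun h'' => h (h''.symm.trans h')]
    · rw [map_zero]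
  p_mul_x α i := end_ext R fun u n => by
    rw [Module.End.mul_apply, repX_basis]
    split_ifs
    · rw [repP_basis, if_pos rfl]
    · rw [map_zero]
  x_mul_p α i := end_ext R fun u n => by
    rw [Module.End.mul_apply, repP_basis]
    split_ifs with h
    · rfl
    · rw [map_zero, repX_basis, if_neg fun h' => h h'.1]
  p_mul_y α i := end_ext R fun u n => by
    rw [Module.End.mul_apply, repY_basis]
    split_ifs
    · rw [repP_basis, if_pos rfl]
    · rw [map_zero]
  y_mul_p α i := end_ext R fun u n => by
    rw [Module.End.mul_apply, repP_basis]
    split_ifs with h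
    · rfl
    · rw [map_zero, repY_basis, if_neg fun h' => h h'.1]
  sum_x_mul_y v hv i j hi hj := end_ext R fun u n => by
    simp only [LinearMap.sum_apply, Module.End.mul_apply]
    -- For given `j` and `n`, `out` selects one structured edge, and only its ghost edge of index
    -- `j` acts nontrivially; hence the sum in (3) has one term.
    have hzero : ∀ α, E.source α = v → ¬(u = v ∧ (B.out v j n).1 = α) →
        B.repX R α i (B.repY R α j (basis R u n)) = 0 := by
      rintro α rfl h
      rw [repY_basis, if_neg, map_zero]
      rintro ⟨rfl, -, h'⟩
      exact h ⟨rfl, h'⟩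
    by_cases huv : u = v
    · subst huv
      rw [Finset.sum_eq_single (B.out u j n).1]
      · rw [repY_basis, if_pos ⟨(B.source_out u j n hj).symm, B.lt_weight_out n hj, rfl⟩,
          repX_basis, B.inv_out u j n hj, B.source_out u j n hj]
        by_cases hij : i = j
        · rw [if_pos ⟨rfl, hij.symm⟩, if_pos hij, repP_basis, if_pos rfl]
        · rw [if_neg fun h => hij h.2.symm, if_neg hij, LinearMap.zero_apply]
      · intro α hα hne
        exact hzero α ((Set.Finite.mem_toFinset hv).1 hα) fun h => hne h.2.symm
      · exact fun h => absurd ((Set.Finite.mem_toFinset hv).2 (B.source_out u j n hj)) h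
    · rw [Finset.sum_eq_zero fun α hα =>
        hzero α ((Set.Finite.mem_toFinset hv).1 hα) fun h => huv h.1]
      split_ifs
      · rw [repP_basis, if_neg huv]
      · rw [LinearMap.zero_apply]
  sum_y_mul_x_self α := end_ext R fun u m => by
    simp only [LinearMap.sum_apply, Module.End.mul_apply]
    rw [repP_basis]
    split_ifs with h
    · subst h
      rw [Finset.sum_eq_single (B.inv α m).1]
      · rw [repY_mul_repX, if_pos ⟨rfl, rfl⟩]
      · intro i _ hi
        rw [repY_mul_repX, if_neg fun h => hi h.1.symm]
      · exact fun h => absurd (Finset.mem_range.2 (B.inv_lt α m)) h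
    · refine Finset.sum_eq_zero fun i _ => ?_
      rw [repX_basis, if_neg fun h' => h h'.1, map_zero]
  sum_y_mul_x_ne α β hne := end_ext R fun u m => by
    simp only [LinearMap.sum_apply, Module.End.mul_apply, LinearMap.zero_apply]
    refine Finset.sum_eq_zero fun i _ => ?_
    by_cases h : u = E.range β
    · subst h
      rw [repY_mul_repX, if_neg fun h => hne h.2]
    · rw [repX_basis, if_neg fun h' => h h'.1, map_zero]

/-- The representation defined by a branching system. -/
noncomputable def rep : E.LeavittPathAlgebra R →ₙₐ[R] Module.End R (V × ℕ →₀ R) :=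
  LeavittPathAlgebra.lift R (B.family R)

open Classical in
theorem rep_p (v u : V) (n : ℕ) : B.rep R ((LeavittPathAlgebra.family E R).p v) (basis R u n) =
    if u = v then basis R u n else 0 := by
  rw [rep, LeavittPathAlgebra.lift_p]; exact repP_basis R v u n

open Classical in
theorem rep_x (α : S) (i : ℕ) (u : V) (n : ℕ) :
    B.rep R ((LeavittPathAlgebra.family E R).x α i) (basis R u n) =
    if u = E.range α ∧ (B.inv α n).1 = i then basis R (E.source α) (B.inv α n).2 else 0 := by
  rw [rep, LeavittPathAlgebra.lift_x]; exact B.repX_basis R α i u n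

open Classical in
theorem rep_y (α : S) (i : ℕ) (u : V) (n : ℕ) :
    B.rep R ((LeavittPathAlgebra.family E R).y α i) (basis R u n) =
    if u = E.source α ∧ i < E.weight α ∧ (B.out u i n).1 = α then
      basis R (E.range α) (B.out u i n).2 else 0 := by
  rw [rep, LeavittPathAlgebra.lift_y]; exact B.repY_basis R α i u n

theorem rep_p_ne_zero [Nontrivial R] (v : V) :
    B.rep R ((LeavittPathAlgebra.family E R).p v) ≠ 0 := by
  intro h
  have := B.rep_p R v v 0
  rw [h, if_pos rfl] at this
  exact basis_ne_zero R v 0 this.symm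

end Representation

/-! ### Construction and twisting of branching systems -/

section Construction

/-- A bijection of `{i // q i} × ℕ` with `ℕ`, extended by junk values to total functions so that no
dependent types enter the branching system. -/
theorem exists_coding {ι : Type*} [Countable ι] [Nonempty ι] (q : ι → Prop) :
    ∃ (enc : ι → ℕ → ℕ) (dec : ℕ → ι × ℕ), (∃ i, q i) →
      (∀ n, q (dec n).1 ∧ enc (dec n).1 (dec n).2 = n) ∧
      ∀ i k, q i → dec (enc i k) = (i, k) := by
  classical
  by_cases h : ∃ i, q i
  · have : Nonempty {i // q i} := nonempty_subtype.2 h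
    obtain ⟨e⟩ : Nonempty ({i // q i} × ℕ ≃ ℕ) := nonempty_equiv_of_countable
    refine ⟨fun i k => if hi : q i then e (⟨i, hi⟩, k) else 0,
      fun n => ((e.symm n).1, (e.symm n).2), fun _ => ⟨fun n => ⟨(e.symm n).1.2, ?_⟩, ?_⟩⟩
    · simp only [dif_pos (e.symm n).1.2]
      exact e.apply_symm_apply n
    · intro i k hi
      simp only [dif_pos hi, Equiv.symm_apply_apply]
  · exact ⟨fun _ _ => 0, fun _ => (Classical.arbitrary ι, 0), fun h' => absurd h' h⟩

/-- There is a branching system in which every pair of an edge and an index that is allowed by `T`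
occurs infinitely often and no other pair occurs. -/
theorem exists_of_allowed [Countable S] [Nonempty S] (T : S → ℕ → Prop) (hT : ∀ α i, T α i → i < E.weight α)
    (hS : ∀ α, ∃ i, T α i)
    (hV : ∀ v i, (∃ α, E.source α = v ∧ i < E.weight α) → ∃ α, E.source α = v ∧ T α i) :
    ∃ B : BranchingSystem E, (∀ α m, T α (B.inv α m).1) ∧
      ∀ α i, T α i → {m | (B.inv α m).1 = i}.Infinite := by
  -- Both sides of the required bijection are coded by triples `(α, i, k)` with `T α i`: for fixed
  -- `i` the pairs `(α, k)` are numbered by `n`, for fixed `α` the pairs `(i, k)` by `m`. The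
  -- hypotheses `hV` and `hS` make these sets nonempty.
  choose enc dec hrow using fun (v : V) (i : ℕ) =>
    exists_coding fun α => E.source α = v ∧ T α i
  choose enc' dec' hcol using fun α => exists_coding (T α)
  refine ⟨{
    out := fun v i n => ((dec v i n).1, enc' (dec v i n).1 i (dec v i n).2)
    inv := fun α m => ((dec' α m).1, enc (E.source α) (dec' α m).1 α (dec' α m).2)
    source_out := fun v i n h => ((hrow v i (hV v i h)).1 n).1.1
    inv_out := fun v i n h => ?_
    inv_lt := fun α m => hT _ _ ((hcol α (hS α)).1 m).1
    out_inv := fun α m => ?_ }, ?_, ?_⟩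
  · obtain ⟨⟨h1, h2⟩, h3⟩ := (hrow v i (hV v i h)).1 n
    simp only [(hcol _ (hS _)).2 _ _ h2, h1, h3]
  · obtain ⟨h1, h2⟩ := (hcol α (hS α)).1 m
    simp only [(hrow _ _ ⟨α, rfl, h1⟩).2 α _ ⟨rfl, h1⟩, h2]
  · exact fun α m => ((hcol α (hS α)).1 m).1
  · intro α i h
    refine Set.infinite_of_injective_forall_mem (f := enc' α i) (fun k k' hk => ?_) fun k => ?_
    · have h1 := (hcol α (hS α)).2 i k h
      rw [hk, (hcol α (hS α)).2 i k' h] at h1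
      exact (congrArg Prod.snd h1).symm
    · exact congrArg Prod.fst ((hcol α (hS α)).2 i k h)

open Classical in
/-- The branching system obtained by permuting the copy of `ℕ` that belongs to an edge. -/
noncomputable def twist (β : S) (σ : Equiv.Perm ℕ) : BranchingSystem E where
  out v i n := ((B.out v i n).1,
    if (B.out v i n).1 = β then σ (B.out v i n).2 else (B.out v i n).2)
  inv α m := B.inv α (if α = β then σ.symm m else m)
  source_out := B.source_out
  inv_out v i n h := by
    split_ifs with h'
    · rw [Equiv.symm_apply_apply, B.inv_out v i n h]
    · exact B.inv_out v i n h
  inv_lt α m := B.inv_lt _ _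
  out_inv α m := by
    simp only [B.out_inv]
    split_ifs <;> simp

theorem twist_out_snd_of_eq {β : S} (σ : Equiv.Perm ℕ) {v : V} {i n : ℕ}
    (h : (B.out v i n).1 = β) : ((B.twist β σ).out v i n).2 = σ (B.out v i n).2 := if_pos h

theorem twist_out_snd_of_ne {β : S} (σ : Equiv.Perm ℕ) {v : V} {i n : ℕ}
    (h : (B.out v i n).1 ≠ β) : ((B.twist β σ).out v i n).2 = (B.out v i n).2 := if_neg h

end Construction

end BranchingSystem

/-! ### Paths from weighted vertices and the twisting argument -/

section ReversePath

variable {V : Type u} {S : Type v} {E : WeightedGraph V S}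

/-- `l` is the sequence of edges, from the last to the first, of a directed path from `a`
to `b`. -/
def IsReversePath (E : WeightedGraph V S) (a : V) : List S → V → Prop
  | [], b => a = b
  | α :: l, b => E.range α = b ∧ IsReversePath E a l (E.source α)

theorem IsReversePath.of_append {a b : V} {l l' : List S} {α : S}
    (h : E.IsReversePath a (l ++ α :: l') b) : E.IsReversePath a (α :: l') (E.range α) := by
  induction l generalizing b with
  | nil => exact ⟨rfl, h.2⟩
  | cons β l ih => exact ih h.2

theorem IsReversePath.reaches {a b : V} {l : List S} (h : E.IsReversePath a l b) :
    E.Reaches a b := by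
  induction l generalizing b with
  | nil => obtain rfl := h; exact .refl
  | cons α l ih => exact (ih h.2).tail ⟨α, rfl, h.1⟩

theorem Reaches.exists_reversePath {a b : V} (h : E.Reaches a b) :
    ∃ l, E.IsReversePath a l b := by
  induction h with
  | refl => exact ⟨[], rfl⟩
  | tail _ h ih =>
    obtain ⟨α, rfl, rfl⟩ := h
    obtain ⟨l, hl⟩ := ih
    exact ⟨α :: l, rfl, hl⟩

namespace LeavittFamily

variable {A : Type*} [NonUnitalRing A] (F : LeavittFamily E A)

/-- The path with the reversed sequence of edges `l` that starts at `a`. -/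
def reversePath (a : V) : List S → A
  | [] => F.p a
  | α :: l => reversePath a l * F.x α 0

/-- The ghost path of the path with the reversed sequence of edges `l` that starts at `a`. -/
def reverseGhostPath (a : V) : List S → A
  | [] => F.p a
  | α :: l => F.y α 0 * reverseGhostPath a l

end LeavittFamily

theorem exists_reversePath_mem (R : Type w) [CommRing R] {G : Type*} [AddCommGroup G]
    (deg : E.Edge → G) (a : V) (l : List S) :
    ∃ g, (LeavittPathAlgebra.family E R).reversePath a l ∈ homogeneousComponent R deg g := by
  induction l with
  | nil => exact ⟨0, family_p_mem R deg a⟩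
  | cons α l ih =>
    obtain ⟨g, hg⟩ := ih
    exact ⟨_, mul_mem_homogeneousComponent R deg hg (family_x_mem R deg ⟨α, 0, E.weight_pos α⟩)⟩

theorem exists_reverseGhostPath_mem (R : Type w) [CommRing R] {G : Type*} [AddCommGroup G]
    (deg : E.Edge → G) (a : V) (l : List S) :
    ∃ g, (LeavittPathAlgebra.family E R).reverseGhostPath a l ∈ homogeneousComponent R deg g := by
  induction l with
  | nil => exact ⟨0, family_p_mem R deg a⟩
  | cons α l ih =>
    obtain ⟨g, hg⟩ := ih
    exact ⟨_, mul_mem_homogeneousComponent R deg (family_y_mem R deg ⟨α, 0, E.weight_pos α⟩) hg⟩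

namespace BranchingSystem

variable (B : BranchingSystem E)

/-- The map of indices by which a ghost path acts on basis vectors if the vertices of the path emit
only one structured edge. -/
def pathMap : List S → ℕ → ℕ
  | [], n => n
  | α :: l, n => (B.out (E.source α) 0 (pathMap l n)).2

theorem out_fst {α : S} (h : {β | E.source β = E.source α}.Subsingleton) {i : ℕ}
    (hi : i < E.weight α) (n : ℕ) : (B.out (E.source α) i n).1 = α :=
  h (B.source_out _ i n ⟨α, rfl, hi⟩) rfl

theorem inv_out_snd {α : S} (h : {β | E.source β = E.source α}.Subsingleton) {i : ℕ}
    (hi : i < E.weight α) (n : ℕ) : B.inv α (B.out (E.source α) i n).2 = (i, n) := by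
  have := B.inv_out (E.source α) i n ⟨α, rfl, hi⟩
  rwa [B.out_fst h hi] at this

theorem out_snd_injective {α : S} (h : {β | E.source β = E.source α}.Subsingleton) :
    Function.Injective fun n => (B.out (E.source α) 0 n).2 := by
  intro m n hmn
  have h1 := B.inv_out_snd h (E.weight_pos α) m
  simp only at hmn
  rw [hmn, B.inv_out_snd h (E.weight_pos α) n] at h1
  exact (congrArg Prod.snd h1).symm

theorem pathMap_injective {l : List S}
    (hl : ∀ α ∈ l, {β | E.source β = E.source α}.Subsingleton) :
    Function.Injective (B.pathMap l) := by
  induction l with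
  | nil => exact Function.injective_id
  | cons α l ih =>
    exact (B.out_snd_injective (hl α (List.mem_cons_self))).comp
      (ih fun β hβ => hl β (List.mem_cons_of_mem _ hβ))

theorem range_pathMap_infinite {l : List S}
    (hl : ∀ α ∈ l, {β | E.source β = E.source α}.Subsingleton) :
    (Set.range (B.pathMap l)).Infinite :=
  Set.infinite_range_of_injective (B.pathMap_injective hl)

/-- If every pair of an edge and an index occurs infinitely often, then a ghost path that ends at a
weighted vertex omits infinitely many indices. -/
theorem compl_range_pathMap_infinite
    (hB : ∀ α i, i < E.weight α → {m | (B.inv α m).1 = i}.Infinite) {a b : V} {α : S} {l : List S}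
    (hl : ∀ β ∈ α :: l, {γ | E.source γ = E.source β}.Subsingleton)
    (h : E.IsReversePath a (α :: l) b) (ha : E.IsWeightedVertex a) :
    (Set.range (B.pathMap (α :: l)))ᶜ.Infinite := by
  induction l generalizing α b with
  | nil =>
    obtain ⟨-, rfl⟩ := h
    obtain ⟨γ, hγ, h1⟩ := ha
    obtain rfl := hl α (List.mem_cons_self) hγ rfl
    -- Ghost paths use the index `0` only. A weighted vertex also has the index `1`, and the
    -- infinitely many numbers belonging to it are missed.
    refine (hB γ 1 h1).mono ?_
    rintro m hm ⟨n, rfl⟩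
    have := B.inv_out_snd (hl γ (List.mem_cons_self)) (E.weight_pos γ) n
    change (B.inv γ (B.out (E.source γ) 0 n).2).1 = 1 at hm
    rw [this] at hm
    exact zero_ne_one hm
  | cons β l ih =>
    have h' := ih (fun γ hγ => hl γ (List.mem_cons_of_mem _ hγ)) h.2
    have hinj := B.out_snd_injective (hl α (List.mem_cons_self))
    refine (h'.image hinj.injOn).mono ?_
    rintro _ ⟨m, hm, rfl⟩ ⟨n, hn⟩
    exact hm ⟨n, hinj hn⟩

theorem pathMap_twist_of_notMem {β : S} (σ : Equiv.Perm ℕ) {l : List S} (hβ : β ∉ l)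
    (hl : ∀ α ∈ l, {β | E.source β = E.source α}.Subsingleton) :
    (B.twist β σ).pathMap l = B.pathMap l := by
  induction l with
  | nil => rfl
  | cons α l ih =>
    rw [List.mem_cons, not_or] at hβ
    funext n
    rw [pathMap, pathMap, ih hβ.2 fun γ hγ => hl γ (List.mem_cons_of_mem _ hγ),
      twist_out_snd_of_ne]
    rw [B.out_fst (hl α (List.mem_cons_self)) (E.weight_pos α)]
    exact Ne.symm hβ.1

/-- The twist acts only at the last edge of the path, since `β` does not occur earlier. The final
number can therefore be permuted arbitrarily. -/
theorem pathMap_twist_cons {β : S} (σ : Equiv.Perm ℕ) {l : List S} (hβ : β ∉ l)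
    (hl : ∀ α ∈ β :: l, {β | E.source β = E.source α}.Subsingleton) (n : ℕ) :
    (B.twist β σ).pathMap (β :: l) n = σ (B.pathMap (β :: l) n) := by
  rw [pathMap, B.pathMap_twist_of_notMem σ hβ fun γ hγ => hl γ (List.mem_cons_of_mem _ hγ),
    twist_out_snd_of_eq, pathMap]
  exact B.out_fst (hl β (List.mem_cons_self)) (E.weight_pos β) _

variable (R : Type w) [CommRing R]

theorem rep_reverseGhostPath {a b : V} {l : List S} (h : E.IsReversePath a l b)
    (hl : ∀ α ∈ l, {β | E.source β = E.source α}.Subsingleton) (n : ℕ) :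
    B.rep R ((LeavittPathAlgebra.family E R).reverseGhostPath a l) (basis R a n) =
      basis R b (B.pathMap l n) := by
  induction l generalizing b with
  | nil => obtain rfl := h; exact (B.rep_p R a a n).trans (if_pos rfl)
  | cons α l ih =>
    obtain ⟨rfl, h⟩ := h
    rw [LeavittFamily.reverseGhostPath, map_mul, Module.End.mul_apply,
      ih h fun γ hγ => hl γ (List.mem_cons_of_mem _ hγ), rep_y, if_pos, pathMap]
    exact ⟨rfl, E.weight_pos α, B.out_fst (hl α (List.mem_cons_self)) (E.weight_pos α) _⟩

theorem rep_reverseGhostPath_of_ne {a u : V} (l : List S) (h : u ≠ a) (n : ℕ) :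
    B.rep R ((LeavittPathAlgebra.family E R).reverseGhostPath a l) (basis R u n) = 0 := by
  induction l with
  | nil => exact (B.rep_p R a u n).trans (if_neg h)
  | cons α l ih => rw [LeavittFamily.reverseGhostPath, map_mul, Module.End.mul_apply, ih, map_zero]

theorem rep_reversePath {a b : V} {l : List S} (h : E.IsReversePath a l b)
    (hl : ∀ α ∈ l, {β | E.source β = E.source α}.Subsingleton) (n : ℕ) :
    B.rep R ((LeavittPathAlgebra.family E R).reversePath a l) (basis R b (B.pathMap l n)) =
      basis R a n := by
  induction l generalizing b with
  | nil => obtain rfl := h; exact (B.rep_p R a a n).trans (if_pos rfl)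
  | cons α l ih =>
    obtain ⟨rfl, h⟩ := h
    rw [LeavittFamily.reversePath, map_mul, Module.End.mul_apply, rep_x, pathMap,
      B.inv_out_snd (hl α (List.mem_cons_self)) (E.weight_pos α), if_pos ⟨rfl, rfl⟩,
      ih h fun γ hγ => hl γ (List.mem_cons_of_mem _ hγ)]

/-- A path acts as a partial inverse of its ghost path: if every step backwards were possible,
`out_inv` would exhibit `m` as a value of `pathMap`. -/
theorem rep_reversePath_of_notMem {a b : V} {l : List S} (h : E.IsReversePath a l b) {m : ℕ}
    (hm : m ∉ Set.range (B.pathMap l)) :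
    B.rep R ((LeavittPathAlgebra.family E R).reversePath a l) (basis R b m) = 0 := by
  induction l generalizing b m with
  | nil => exact absurd ⟨m, rfl⟩ hm
  | cons α l ih =>
    obtain ⟨rfl, h⟩ := h
    rw [LeavittFamily.reversePath, map_mul, Module.End.mul_apply, rep_x]
    split_ifs with h0
    · refine ih h ?_
      rintro ⟨n, hn⟩
      refine hm ⟨n, ?_⟩
      have := B.out_inv α m
      rw [h0.2, ← hn] at this
      rw [pathMap, this]
    · rw [map_zero]

end BranchingSystem

/-- An infinite set of natural numbers can be moved into every infinite set, if the complements are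
infinite too. -/
theorem exists_perm_mapsTo {A D : Set ℕ} (hA : A.Infinite) (hA' : Aᶜ.Infinite) (hD : D.Infinite)
    (hD' : Dᶜ.Infinite) : ∃ σ : Equiv.Perm ℕ, ∀ n ∈ A, σ n ∈ D := by
  classical
  have := hA.to_subtype
  have := hA'.to_subtype
  have := hD.to_subtype
  have := hD'.to_subtype
  obtain ⟨e⟩ : Nonempty (A ≃ D) := nonempty_equiv_of_countable
  obtain ⟨e'⟩ : Nonempty (↥Aᶜ ≃ ↥Dᶜ) := nonempty_equiv_of_countable
  refine ⟨(Equiv.Set.sumCompl A).symm.trans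
    ((Equiv.sumCongr e e').trans (Equiv.Set.sumCompl D)), fun n hn => ?_⟩
  simp [Equiv.Set.sumCompl_symm_apply_of_mem hn]

namespace BranchingSystem

variable (B : BranchingSystem E)

/-- The homogeneous element is `y` times the ghost path. The set `D` of vectors at `b` not killed by
`y` is the same for all twists, whereas the image of the ghost path can be moved by `σ`, either into
the complement of `D` or so as to meet `D`. -/
theorem not_isGradedSimple_of_twist {R : Type w} [CommRing R] [Nontrivial R]
    {G : Type*} [AddCommGroup G] {deg : E.Edge → G}
    (hB : ∀ α i, i < E.weight α → {m | (B.inv α m).1 = i}.Infinite) {a b : V} {β : S} {l : List S}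
    (hβ : β ∉ l) (hl : ∀ α ∈ β :: l, {γ | E.source γ = E.source α}.Subsingleton)
    (h : E.IsReversePath a (β :: l) b) (ha : E.IsWeightedVertex a)
    {g : G} {y : E.LeavittPathAlgebra R} (hy : y ∈ homogeneousComponent R deg g)
    {D : Set ℕ} (hD : D.Infinite) (hD' : Dᶜ.Infinite)
    (hyD : ∀ σ m, (B.twist β σ).rep R y (basis R b m) ≠ 0 ↔ m ∈ D) :
    ¬ IsGradedSimple R deg := by
  intro hs
  obtain ⟨g', hg'⟩ := exists_reverseGhostPath_mem R deg a (β :: l)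
  have hx := mul_mem_homogeneousComponent R deg hy hg'
  obtain ⟨σ, hσ⟩ := exists_perm_mapsTo (B.range_pathMap_infinite hl)
    (B.compl_range_pathMap_infinite hB hl h ha) hD' (by rwa [compl_compl])
  have h0 := hs.eq_zero_of_map_eq_zero (A := Module.End R (V × ℕ →₀ R)) hx
    ((B.twist β σ).rep R) ?_ ((B.twist β σ).rep_p_ne_zero R a)
  · obtain ⟨m, hm⟩ := hD.nonempty
    -- This swap puts the image of the vector `0` at `a` onto a chosen element of `D`, so here the
    -- product does not vanish.
    have h1 : (B.twist β (Equiv.swap (B.pathMap (β :: l) 0) m)).rep R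
        (y * (LeavittPathAlgebra.family E R).reverseGhostPath a (β :: l)) (basis R a 0) = 0 := by
      rw [h0, map_zero, LinearMap.zero_apply]
    rw [map_mul, Module.End.mul_apply, rep_reverseGhostPath _ R h hl,
      B.pathMap_twist_cons _ hβ hl, Equiv.swap_apply_left] at h1
    exact (hyD _ m).2 hm h1
  · refine end_ext R fun u n => ?_
    rw [map_mul, Module.End.mul_apply, LinearMap.zero_apply]
    by_cases hu : u = a
    · subst hu
      rw [rep_reverseGhostPath _ R h hl, B.pathMap_twist_cons _ hβ hl]
      by_contra hne
      exact hσ _ ⟨n, rfl⟩ ((hyD _ _).1 hne)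
    · rw [rep_reverseGhostPath_of_ne _ R _ hu, map_zero]

end BranchingSystem

end ReversePath

end WeightedGraph

namespace WeightedGraph

/-! ### Graded simplicity forces reducibility -/

section Irreducible

variable {V : Type u} {S : Type v} {E : WeightedGraph V S} {R : Type w} [CommRing R] [Nontrivial R]
  {G : Type*} [AddCommGroup G] {deg : E.Edge → G}

/-- There is a branching system in which every pair of an edge and an index occurs infinitely
often. -/
theorem BranchingSystem.exists_generic (E : WeightedGraph V S) [Countable S] [Nonempty S] :
    ∃ B : BranchingSystem E,
      ∀ α i, i < E.weight α → {m | (B.inv α m).1 = i}.Infinite := by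
  obtain ⟨B, -, hB⟩ := BranchingSystem.exists_of_allowed (E := E) (fun α i => i < E.weight α)
    (fun _ _ h => h) (fun α => ⟨0, E.weight_pos α⟩) (fun _ _ h => h)
  exact ⟨B, hB⟩

/-- With a second structured edge available at `v`, some representation pairs `β` with nonzero
indices only. There `β_1` acts as zero, but in a generic representation it does not. -/
theorem IsGradedSimple.subsingleton_of_isWeightedVertex [Countable S] (hE : E.RowFinite)
    (hs : IsGradedSimple R deg) {v : V} (hv : E.IsWeightedVertex v) :
    {α | E.source α = v}.Subsingleton := by
  classical
  rw [← Set.not_nontrivial_iff]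
  intro hn
  obtain ⟨β, hβ, hmax⟩ := Set.exists_max_image _ E.weight (hE v) hn.nonempty
  obtain ⟨γ, hγ, hγβ⟩ := hn.exists_ne β
  obtain ⟨δ, hδ, h1⟩ := hv
  have h1 : 1 < E.weight β := h1.trans_le (hmax δ hδ)
  have : Nonempty S := ⟨β⟩
  obtain ⟨B, hB⟩ := BranchingSystem.exists_generic E
  -- At `v` the index `0` is left to the edges other than `β`, and `β` takes all other indices,
  -- which is possible because its weight is maximal. As `β` has weight above 1, it keeps at least
  -- the index `1`.
  obtain ⟨B', hB', -⟩ := BranchingSystem.exists_of_allowed (E := E)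
    (fun α i => i < E.weight α ∧ (E.source α = v → (α = β ↔ i ≠ 0))) (fun _ _ h => h.1)
    (fun α => by
      by_cases h : α = β
      · subst h
        exact ⟨1, h1, fun _ => iff_of_true rfl one_ne_zero⟩
      · exact ⟨0, E.weight_pos α, fun _ => iff_of_false h fun h' => h' rfl⟩)
    (fun u i ⟨α, hα, hi⟩ => by
      by_cases hu : u = v
      · subst hu
        by_cases h0 : i = 0
        · subst h0
          exact ⟨γ, hγ, E.weight_pos γ, fun _ => iff_of_false hγβ fun h' => h' rfl⟩
        · exact ⟨β, hβ, hi.trans_le (hmax α hα), fun _ => iff_of_true rfl h0⟩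
      · exact ⟨α, hα, hi, fun h => absurd (hα.symm.trans h) hu⟩)
  have h0 := hs.eq_zero_of_map_eq_zero (A := Module.End R (V × ℕ →₀ R))
    (family_x_mem R deg ⟨β, 0, E.weight_pos β⟩) (B'.rep R) ?_ (B'.rep_p_ne_zero R v)
  · obtain ⟨m, hm⟩ := (hB β 0 (E.weight_pos β)).nonempty
    have := B.rep_x R β 0 (E.range β) m
    rw [if_pos ⟨rfl, hm⟩] at this
    refine BranchingSystem.basis_ne_zero R _ _ (this.symm.trans ?_)
    change (LeavittPathAlgebra.family E R).x β 0 = 0 at h0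
    rw [h0, map_zero, LinearMap.zero_apply]
  · refine BranchingSystem.end_ext R fun u n => ?_
    change B'.rep R ((LeavittPathAlgebra.family E R).x β 0) _ = 0
    rw [BranchingSystem.rep_x, if_neg]
    rintro ⟨-, h⟩
    exact ((hB' β n).2 hβ).1 rfl h

theorem exists_shortest {q : V → List S → Prop} (h : ∃ a l, q a l) :
    ∃ a l, q a l ∧ ∀ a' l', q a' l' → l.length ≤ l'.length := by
  classical
  have hex : ∃ n, ∃ a l, q a l ∧ l.length = n := by
    obtain ⟨a, l, h⟩ := h
    exact ⟨_, a, l, h, rfl⟩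
  obtain ⟨a, l, hq, hl⟩ := Nat.find_spec hex
  exact ⟨a, l, hq, fun a' l' h' => hl ▸ Nat.find_min' hex ⟨a', l', h', rfl⟩⟩

/-- A shortest path from a weighted vertex to a vertex `b` that emits two structured edges `α` and
`γ` runs through vertices that emit only one. The twisting argument applies with `y = α_1^*`: at `b`
infinitely many numbers lead to `α` and infinitely many to `γ`. -/
theorem IsGradedSimple.subsingleton_source [Countable S] (hE : E.RowFinite)
    (hs : IsGradedSimple R deg) {v : V} (hv : v ∈ E.weightForest) :
    {α | E.source α = v}.Subsingleton := by
  by_contra hn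
  obtain ⟨a, l, ⟨ha, b, hl, hb⟩, hmin⟩ := exists_shortest
    (q := fun a l => E.IsWeightedVertex a ∧ ∃ b, E.IsReversePath a l b ∧
      ¬ {α | E.source α = b}.Subsingleton) (by
        obtain ⟨a, ha, hr⟩ := hv
        obtain ⟨l, hl⟩ := Reaches.exists_reversePath hr
        exact ⟨a, l, ha, v, hl, hn⟩)
  have hsing : ∀ α ∈ l, {γ | E.source γ = E.source α}.Subsingleton := by
    intro α hα
    by_contra h
    obtain ⟨l₁, l₂, rfl⟩ := List.append_of_mem hα
    have := hmin a l₂ ⟨ha, _, hl.of_append.2, h⟩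
    simp at this
    omega
  cases l with
  | nil =>
    obtain rfl := hl
    exact hb (hs.subsingleton_of_isWeightedVertex hE ha)
  | cons β l =>
    have hβ : β ∉ l := by
      intro hβ
      obtain ⟨l₁, l₂, rfl⟩ := List.append_of_mem hβ
      have := hmin a (β :: l₂) ⟨ha, _, hl.2.of_append, hl.1.symm ▸ hb⟩
      simp at this
      omega
    rw [Set.not_subsingleton_iff] at hb
    obtain ⟨α, hα, γ, hγ, hne⟩ := hb
    have : Nonempty S := ⟨β⟩
    obtain ⟨B, hB⟩ := BranchingSystem.exists_generic E
    -- The numbers that `δ` pairs with the index `0` are infinitely many, and following `inv` gives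
    -- distinct numbers at `b`.
    have hD : ∀ δ, E.source δ = b → {m | (B.out b 0 m).1 = δ}.Infinite := by
      rintro δ rfl
      refine ((hB δ 0 (E.weight_pos δ)).image (f := fun m => (B.inv δ m).2) ?_).mono ?_
      · intro m hm m' hm' h
        have h1 := B.out_inv δ m
        have h2 := B.out_inv δ m'
        rw [show (B.inv δ m).1 = 0 from hm, show (B.inv δ m).2 = _ from h] at h1
        rw [show (B.inv δ m').1 = 0 from hm', h1] at h2
        exact congrArg Prod.snd h2
      · rintro _ ⟨m, hm, rfl⟩
        have h1 := B.out_inv δ m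
        rw [show (B.inv δ m).1 = 0 from hm] at h1
        exact congrArg Prod.fst h1
    refine B.not_isGradedSimple_of_twist hB hβ hsing hl ha
      (family_y_mem R deg ⟨α, 0, E.weight_pos α⟩) (hD α hα) ((hD γ hγ).mono ?_) ?_ hs
    · intro m hm hm'
      exact hne (hm'.symm.trans hm)
    · intro σ m
      change (B.twist β σ).rep R ((LeavittPathAlgebra.family E R).y α 0) _ ≠ 0 ↔ _
      rw [BranchingSystem.rep_y]
      split_ifs with h
      · exact iff_of_true (BranchingSystem.basis_ne_zero R _ _) h.2.2
      · exact iff_of_false (fun h' => h' rfl) fun h' => h ⟨hα.symm, E.weight_pos α, h'⟩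

/-- Two structured edges into `v` from the weight forest are ends of two paths from weighted
vertices. The twisting argument applies to the first path times the ghost of the second: a path
kills exactly the vectors outside the image of its ghost path. -/
theorem IsGradedSimple.subsingleton_range [Countable S] (hE : E.RowFinite)
    (hs : IsGradedSimple R deg) (v : V) :
    {α | E.range α = v ∧ E.source α ∈ E.weightForest}.Subsingleton := by
  by_contra hn
  have hsing : ∀ {a l b}, E.IsWeightedVertex a → E.IsReversePath a l b →
      ∀ α ∈ l, {γ | E.source γ = E.source α}.Subsingleton := by
    intro a l b ha hl α hα
    obtain ⟨l₁, l₂, rfl⟩ := List.append_of_mem hα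
    exact hs.subsingleton_source hE ⟨a, ha, hl.of_append.2.reaches⟩
  have hex : ∀ α, E.range α = v → E.source α ∈ E.weightForest →
      ∃ a l, E.IsWeightedVertex a ∧ E.IsReversePath a (α :: l) v := by
    rintro α hr ⟨a, ha, h⟩
    obtain ⟨l, hl⟩ := Reaches.exists_reversePath h
    exact ⟨a, l, ha, hr, hl⟩
  rw [Set.not_subsingleton_iff] at hn
  obtain ⟨α₁, hα₁, α₂, hα₂, hne⟩ := hn
  -- `α` is whichever of the two edges ends the shorter connection. Minimality then keeps the other
  -- edge `β` off this path, so a twist at `β` does not affect it.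
  obtain ⟨a, l₀, ⟨ha, α, l, rfl, hl, hα⟩, hmin⟩ := exists_shortest
    (q := fun a l₀ => E.IsWeightedVertex a ∧ ∃ α l, l₀ = α :: l ∧
      E.IsReversePath a (α :: l) v ∧ (α = α₁ ∨ α = α₂)) (by
        obtain ⟨a, l, ha, hl⟩ := hex α₁ hα₁.1 hα₁.2
        exact ⟨a, _, ha, α₁, l, rfl, hl, Or.inl rfl⟩)
  obtain ⟨β, hβα, hβ, hrβ, hsβ⟩ : ∃ β, β ≠ α ∧ (β = α₁ ∨ β = α₂) ∧ E.range β = v ∧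
      E.source β ∈ E.weightForest := by
    rcases hα with rfl | rfl
    · exact ⟨α₂, hne.symm, Or.inr rfl, hα₂⟩
    · exact ⟨α₁, hne, Or.inl rfl, hα₁⟩
  have hβl : β ∉ α :: l := by
    rw [List.mem_cons, not_or]
    refine ⟨hβα, fun h => ?_⟩
    obtain ⟨l₁, l₂, rfl⟩ := List.append_of_mem h
    have := hmin a (β :: l₂) ⟨ha, β, l₂, rfl, hrβ ▸ hl.2.of_append, hβ⟩
    simp at this
    omega
  obtain ⟨a', l', ⟨ha', hl'⟩, hmin'⟩ := exists_shortest
    (q := fun a l => E.IsWeightedVertex a ∧ E.IsReversePath a (β :: l) v) (hex β hrβ hsβ)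
  have hβl' : β ∉ l' := by
    intro h
    obtain ⟨l₁, l₂, rfl⟩ := List.append_of_mem h
    have := hmin' a' l₂ ⟨ha', hrβ ▸ hl'.2.of_append⟩
    simp at this
    omega
  have : Nonempty S := ⟨β⟩
  obtain ⟨B, hB⟩ := BranchingSystem.exists_generic E
  obtain ⟨g, hg⟩ := exists_reversePath_mem R deg a (α :: l)
  refine B.not_isGradedSimple_of_twist hB hβl' (hsing ha' hl') hl' ha' hg
    (B.range_pathMap_infinite (hsing ha hl))
    (B.compl_range_pathMap_infinite hB (hsing ha hl) hl ha) (fun σ m => ?_) hs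
  -- The set `D` is the image of the ghost path through `α`, which is the same before and after the
  -- twist at `β`.
  rw [← B.pathMap_twist_of_notMem σ hβl (hsing ha hl)]
  constructor
  · intro h
    by_contra hm
    exact h (BranchingSystem.rep_reversePath_of_notMem _ R hl hm)
  · rintro ⟨n, rfl⟩
    rw [BranchingSystem.rep_reversePath _ R hl (hsing ha hl)]
    exact BranchingSystem.basis_ne_zero R _ _

theorem IsGradedSimple.isReducible [Countable S] (hE : E.RowFinite)
    (hs : IsGradedSimple R deg) : E.IsReducible :=
  fun v hv => ⟨hs.subsingleton_source hE hv, hs.subsingleton_range hE v⟩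

end Irreducible
end WeightedGraph

theorem mainTheorem3 {V : Type*} {S : Type*} [Countable V] [Countable S]
    (E : WeightedGraph V S) (hE : E.RowFinite) (R : Type*) [Field R] :
    WeightedGraph.IsGradedSimple R E.multidegree ↔
      E.IsReducible ∧ WeightedGraph.IsGradedSimple R E.unweighted.unitDegree := by
  constructor
  · intro h
    have hred := h.isReducible hE
    exact ⟨hred, (hred.isGradedSimple_iff hE R).1 h⟩
  · rintro ⟨hred, h⟩
    exact (hred.isGradedSimple_iff hE R).2 h
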